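/- Fix real numbers \(k_0\ge 0\) and \(k_1\ge k_0\). Let \(A_1\) be the set of \(q\in L_1[0,1]\) with \(q\ge 0\) a.e. and \(\int_0^1 q\,dx=1\). For \(q\in A_1\) let \(\lambda_1(-q)\) be the minimal eigenvalue of the problem \[-y''-qy=\lambda y,\qquad y'(0)-k_0^2y(0)=y'(1)+k_1^2y(1)=0,\qquad y\in W_1^2[0,1],\] (the equation holding a.e.), and put \(m_1^-=\inf_{q\in A_1}\lambda_1(-q)\). Let \(W_2^{-1}[0,1]\) be the dual of the real Sobolev space \(W_2^1[0,1]\) (equivalently, the completion of \(L_2[0,1]\) in the dual norm). Let \(\Gamma_1\) be the closure in \(W_2^{-1}[0,1]\) of \(A_1\), where \(q\in A_1\) is identified with the functional \(z\mapsto\int_0^1qz\,dx\). For \(q\in W_2^{-1}[0,1]\), \(\lambda\) is an eigenvalue for \(q\) if there is \(y\in W_2^1[0,1]\), \(y\ne0\), such that for all \(z\in W_2^1[0,1]\) \[\int_0^1\left[y'z'-\lambda yz\right]dx+\langle q,yz\rangle+k_0^2y(0)z(0)+k_1^2y(1)z(1)=0,\] and \(\lambda_1(q)\) is the minimal eigenvalue.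 We say that \(m_1^-\) is attained at a potential \(q^*\in-\Gamma_1\) if \(\lambda_1(q^*)=m_1^-\) and \(\lambda_1(q)\ge m_1^-\) for all \(q\in-\Gamma_1\). Let \(\boldsymbol\delta_\zeta\) be the Dirac delta function at \(\zeta\in[0,1]\), that is, \(\langle\boldsymbol\delta_\zeta,z\rangle=z(\zeta)\). **Theorem.** If for some \(\mu\ge-k_0^4\) and some \(\zeta\in(0,1)\) the problem \[-y''=\mu y\quad\text{on }(0,\zeta)\cup(\zeta,1),\] \[y'(0)-k_0^2y(0)=2y'(\zeta-0)-y(\zeta)=2y'(\zeta+0)+y(\zeta)=y'(1)+k_1^2y(1)=0\] has a continuous positive solution on \([0,1]\), then \(m_1^-=\mu\), and \(m_1^-\) is attained at the potential \(-\boldsymbol\delta_\zeta\). If there are no such \(\mu\) and \(\zeta\), then \(m_1^-\) is the minimal eigenvalue of the problem \[-y''=\lambda y,\qquad y'(0)-(k_0^2-1)y(0)=y'(1)+k_1^2y(1)=0,\] and \(m_1^-\) is attained at the potential \(-\boldsymbol\delta_0\). -/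

import Mathlib

open Set Filter Topology MeasureTheory unitInterval

noncomputable section

namespace SturmDelta

/-! ### The Sobolev space `W_2^1[0,1]` -/

/-- The extension to `ℝ` of a function on `[0,1]`, constant on either side of `[0,1]`. -/
def ext (y : I → ℝ) : ℝ → ℝ := IccExtend zero_le_one y

/-- Membership in `W_2^1[0,1]`: absolutely continuous on `[0,1]`, with derivative in `L_2`. -/
def MemW21 (y : I → ℝ) : Prop :=
  AbsolutelyContinuousOnInterval (ext y) 0 1 ∧
    MemLp (deriv (ext y)) 2 (volume.restrict (Ioc 0 1))

theorem ext_add (y z : I → ℝ) : ext (y + z) = fun x => ext y x + ext z x := rfl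

theorem ext_mul (y z : I → ℝ) : ext (y * z) = fun x => ext y x * ext z x := rfl

theorem ext_smul (c : ℝ) (y : I → ℝ) : ext (c • y) = fun x => c * ext y x := rfl

theorem ext_const (c : ℝ) : ext (fun _ => c) = fun _ => c := rfl

theorem ae_diff {f : ℝ → ℝ} (hf : AbsolutelyContinuousOnInterval f 0 1) :
    ∀ᵐ x ∂(volume.restrict (Ioc (0 : ℝ) 1)), DifferentiableAt ℝ f x := by
  rw [ae_restrict_iff' measurableSet_Ioc]
  filter_upwards [hf.ae_differentiableAt] with x hx h
  exact hx (by rw [uIcc_of_le zero_le_one]; exact Ioc_subset_Icc_self h)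

theorem deriv_ext_add {y z : I → ℝ} (hy : MemW21 y) (hz : MemW21 z) :
    deriv (ext (y + z)) =ᵐ[volume.restrict (Ioc (0 : ℝ) 1)]
      fun x => deriv (ext y) x + deriv (ext z) x := by
  filter_upwards [ae_diff hy.1, ae_diff hz.1] with x h1 h2
  rw [ext_add]
  exact (h1.hasDerivAt.fun_add h2.hasDerivAt).deriv

theorem deriv_ext_mul {y z : I → ℝ} (hy : MemW21 y) (hz : MemW21 z) :
    deriv (ext (y * z)) =ᵐ[volume.restrict (Ioc (0 : ℝ) 1)]
      fun x => deriv (ext y) x * ext z x + ext y x * deriv (ext z) x := by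
  filter_upwards [ae_diff hy.1, ae_diff hz.1] with x h1 h2
  rw [ext_mul]
  exact (h1.hasDerivAt.fun_mul h2.hasDerivAt).deriv

theorem deriv_ext_smul (c : ℝ) (y : I → ℝ) :
    deriv (ext (c • y)) = fun x => c * deriv (ext y) x := by
  funext x
  rw [ext_smul]
  exact deriv_const_mul_field c

theorem MemW21.continuous {y : I → ℝ} (hy : MemW21 y) : Continuous (ext y) := by
  have h1 : ContinuousOn (ext y) (Icc 0 1) := by
    have := hy.1.continuousOn
    rwa [uIcc_of_le zero_le_one] at this
  have h2 : ext y = fun x => ext y (projIcc (0 : ℝ) 1 zero_le_one x : ℝ) := by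
    funext x
    simp [ext, IccExtend]
  rw [h2]
  exact h1.comp_continuous (continuous_subtype_val.comp continuous_projIcc)
    (fun x => (projIcc (0 : ℝ) 1 zero_le_one x).2)

theorem MemW21.memLp {y : I → ℝ} (hy : MemW21 y) :
    MemLp (ext y) 2 (volume.restrict (Ioc 0 1)) := by
  have hc := hy.continuous
  obtain ⟨C, hC⟩ := isCompact_Icc.exists_bound_of_continuousOn (hc.continuousOn (s := Icc (0 : ℝ) 1))
  refine MemLp.of_bound hc.aestronglyMeasurable C ?_
  rw [ae_restrict_iff' measurableSet_Ioc]
  exact Eventually.of_forall fun x hx => hC x (Ioc_subset_Icc_self hx)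

theorem MemW21.add {y z : I → ℝ} (hy : MemW21 y) (hz : MemW21 z) : MemW21 (y + z) := by
  refine ⟨hy.1.add hz.1, ?_⟩
  rw [memLp_congr_ae (deriv_ext_add hy hz)]
  exact hy.2.add hz.2

theorem MemW21.mul {y z : I → ℝ} (hy : MemW21 y) (hz : MemW21 z) : MemW21 (y * z) := by
  refine ⟨hy.1.mul hz.1, ?_⟩
  rw [memLp_congr_ae (deriv_ext_mul hy hz)]
  have key : ∀ {u v : I → ℝ}, MemW21 u → MemW21 v →
      MemLp (fun x => deriv (ext u) x * ext v x) 2 (volume.restrict (Ioc 0 1)) := by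
    intro u v hu hv
    obtain ⟨C, hC⟩ := isCompact_Icc.exists_bound_of_continuousOn
      (hv.continuous.continuousOn (s := Icc (0 : ℝ) 1))
    refine MemLp.of_le_mul (c := C) hu.2
      (hu.2.aestronglyMeasurable.mul hv.continuous.aestronglyMeasurable) ?_
    rw [ae_restrict_iff' measurableSet_Ioc]
    refine Eventually.of_forall fun x hx => ?_
    rw [norm_mul, mul_comm]
    exact mul_le_mul_of_nonneg_right (hC x (Ioc_subset_Icc_self hx)) (norm_nonneg _)
  refine (key hy hz).add ?_
  have := key hz hy
  refine this.congr_norm ?_ ?_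
  · exact hy.continuous.aestronglyMeasurable.mul hz.2.aestronglyMeasurable
  · exact Eventually.of_forall fun x => by simp [mul_comm]

theorem memW21_const (c : ℝ) : MemW21 (fun _ => c) := by
  have h : AbsolutelyContinuousOnInterval (fun _ : ℝ => c) 0 1 :=
    (LipschitzWith.const c).lipschitzOnWith.absolutelyContinuousOnInterval
  refine ⟨h, ?_⟩
  rw [ext_const]
  simp

/-- The functions of class `W_2^1[0,1]`, with their pointwise operations. -/
def subW21 : Subalgebra ℝ (I → ℝ) where
  carrier := {y | MemW21 y}
  add_mem' := MemW21.add
  mul_mem' := MemW21.mul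
  algebraMap_mem' c := memW21_const c

/-- The space `W_2^1[0,1]`. -/
def W21 : Type := subW21

instance : CommRing W21 := inferInstanceAs (CommRing subW21)

instance : Algebra ℝ W21 := inferInstanceAs (Algebra ℝ subW21)

namespace W21

/-- A function of class `W_2^1[0,1]`, as a function on `ℝ` (constant outside `[0,1]`). -/
def fn (y : W21) : ℝ → ℝ := ext y.1

/-- The derivative of a function of class `W_2^1[0,1]`. -/
def der (y : W21) : ℝ → ℝ := deriv y.fn

theorem fn_add (y z : W21) (x : ℝ) : (y + z).fn x = y.fn x + z.fn x := rfl

theorem fn_mul (y z : W21) (x : ℝ) : (y * z).fn x = y.fn x * z.fn x := rfl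

theorem fn_smul (c : ℝ) (y : W21) (x : ℝ) : (c • y).fn x = c * y.fn x := rfl

theorem continuous_fn (y : W21) : Continuous y.fn := MemW21.continuous y.2

theorem memLp_fn (y : W21) : MemLp y.fn 2 (volume.restrict (Ioc 0 1)) := MemW21.memLp y.2

theorem memLp_der (y : W21) : MemLp y.der 2 (volume.restrict (Ioc 0 1)) := y.2.2

theorem der_add (y z : W21) :
    (y + z).der =ᵐ[volume.restrict (Ioc (0 : ℝ) 1)] fun x => y.der x + z.der x :=
  deriv_ext_add y.2 z.2

theorem der_smul (c : ℝ) (y : W21) : (c • y).der = fun x => c * y.der x :=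
  deriv_ext_smul c y.1

theorem integrable_fn (y z : W21) :
    Integrable (fun x => y.fn x * z.fn x) (volume.restrict (Ioc 0 1)) :=
  y.memLp_fn.integrable_mul z.memLp_fn

theorem integrable_der (y z : W21) :
    Integrable (fun x => y.der x * z.der x) (volume.restrict (Ioc 0 1)) :=
  y.memLp_der.integrable_mul z.memLp_der

theorem integrable_inner (y z : W21) :
    Integrable (fun x => y.fn x * z.fn x + y.der x * z.der x) (volume.restrict (Ioc 0 1)) :=
  (integrable_fn y z).add (integrable_der y z)

/-- The inner product `∫₀¹ (y z + y' z') dx` of `W_2^1[0,1]`. -/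
@[reducible] def core : InnerProductSpace.Core ℝ W21 where
  inner y z := ∫ x in (0 : ℝ)..1, (y.fn x * z.fn x + y.der x * z.der x)
  conj_inner_symm y z := by
    simp only [conj_trivial]
    congr 1
    funext x
    ring
  re_inner_nonneg y := by
    simp only [RCLike.re_to_real]
    exact intervalIntegral.integral_nonneg zero_le_one fun x _ =>
      add_nonneg (mul_self_nonneg _) (mul_self_nonneg _)
  add_left y z w := by
    simp only [intervalIntegral.integral_of_le (zero_le_one' ℝ)]
    rw [← integral_add (integrable_inner y w) (integrable_inner z w)]
    refine integral_congr_ae ?_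
    filter_upwards [der_add y z] with x hx
    rw [hx, fn_add]
    ring
  smul_left y z c := by
    simp only [conj_trivial]
    rw [← intervalIntegral.integral_const_mul]
    congr 1
    funext x
    rw [der_smul, fn_smul]
    ring
  definite y hy := by
    rw [intervalIntegral.integral_of_le (zero_le_one' ℝ),
      integral_eq_zero_iff_of_nonneg
        (fun x => add_nonneg (mul_self_nonneg _) (mul_self_nonneg _)) (integrable_inner y y)] at hy
    have h1 : y.fn =ᵐ[volume.restrict (Ioc (0 : ℝ) 1)] fun _ => 0 := by
      filter_upwards [hy] with x hx
      have : y.fn x * y.fn x + y.der x * y.der x = 0 := hx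
      nlinarith [mul_self_nonneg (y.fn x), mul_self_nonneg (y.der x)]
    rw [Measure.restrict_congr_set Ioc_ae_eq_Icc] at h1
    have h2 : EqOn y.fn (fun _ => 0) (Icc 0 1) :=
      Measure.eqOn_Icc_of_ae_eq volume (zero_ne_one' ℝ) h1 y.continuous_fn.continuousOn
        continuousOn_const
    refine Subtype.ext ?_
    funext t
    have := h2 t.2
    have h3 : y.1 t = 0 := by simpa [fn, ext] using this
    exact h3

instance : NormedAddCommGroup W21 := core.toNormedAddCommGroup

instance : InnerProductSpace ℝ W21 := InnerProductSpace.ofCore core.toCore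

theorem norm_sq (y : W21) :
    ‖y‖ ^ 2 = ∫ x in (0 : ℝ)..1, (y.fn x * y.fn x + y.der x * y.der x) :=
  (real_inner_self_eq_norm_sq y).symm

/-- The embedding of `W_2^1[0,1]` into the bounded functions. -/
theorem abs_fn_le (y : W21) {x : ℝ} (hx : x ∈ Icc (0 : ℝ) 1) : |y.fn x| ≤ 2 * ‖y‖ := by
  rcases eq_or_ne y 0 with rfl | hy
  · have : (0 : W21).fn x = 0 := rfl
    simp [this]
  have hs : 0 < ‖y‖ := norm_pos_iff.mpr hy
  have hac : AbsolutelyContinuousOnInterval y.fn 0 1 := y.2.1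
  have hint : IntervalIntegrable y.der volume 0 1 := hac.intervalIntegrable_deriv
  have hfint : IntervalIntegrable (fun t => |y.fn t|) volume 0 1 :=
    y.continuous_fn.abs.intervalIntegrable 0 1
  have h1 : ∀ t ∈ Icc (0 : ℝ) 1, |y.fn x| ≤ |y.fn t| + ∫ u in (0 : ℝ)..1, |y.der u| := by
    intro t ht
    have hsub : uIcc t x ⊆ uIcc (0 : ℝ) 1 := by
      rw [uIcc_of_le (zero_le_one' ℝ)]
      exact uIcc_subset_Icc ht hx
    have e : ∫ u in t..x, y.der u = y.fn x - y.fn t := (hac.mono hsub).integral_deriv_eq_sub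
    have e2 : |∫ u in t..x, y.der u| ≤ ∫ u in (0 : ℝ)..1, |y.der u| := by
      have e3 : |∫ u in t..x, y.der u| ≤ ∫ u in uIoc t x, |y.der u| := by
        simp only [← Real.norm_eq_abs]
        exact intervalIntegral.norm_integral_le_integral_norm_uIoc
      refine e3.trans ?_
      rw [intervalIntegral.integral_of_le (zero_le_one' ℝ)]
      refine setIntegral_mono_set hint.1.norm (Eventually.of_forall fun _ => abs_nonneg _) ?_
      refine (Ioc_subset_Ioc ?_ ?_).eventuallyLE
      · exact le_min ht.1 hx.1
      · exact max_le ht.2 hx.2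
    rw [e] at e2
    have := abs_sub_abs_le_abs_sub (y.fn x) (y.fn t)
    linarith
  have h2 : |y.fn x| ≤ (∫ t in (0 : ℝ)..1, |y.fn t|) + ∫ u in (0 : ℝ)..1, |y.der u| := by
    have := intervalIntegral.integral_mono_on (zero_le_one' ℝ)
      (_root_.intervalIntegrable_const (c := |y.fn x|))
      (hfint.add (_root_.intervalIntegrable_const (c := ∫ u in (0 : ℝ)..1, |y.der u|))) h1
    simpa [intervalIntegral.integral_add hfint] using this
  have hii : IntervalIntegrable (fun t => y.fn t * y.fn t + y.der t * y.der t) volume 0 1 := by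
    rw [intervalIntegrable_iff_integrableOn_Ioc_of_le zero_le_one]
    exact integrable_inner y y
  have h3 : (∫ t in (0 : ℝ)..1, |y.fn t|) + ∫ u in (0 : ℝ)..1, |y.der u|
      ≤ ∫ t in (0 : ℝ)..1, (y.fn t * y.fn t + y.der t * y.der t) * (1 / (2 * ‖y‖)) + ‖y‖ := by
    rw [← intervalIntegral.integral_add hfint hint.abs]
    refine intervalIntegral.integral_mono_on zero_le_one (hfint.add hint.abs)
      ((hii.mul_const _).add _root_.intervalIntegrable_const) fun t _ => ?_
    have a1 : (y.fn t * y.fn t + y.der t * y.der t) * (1 / (2 * ‖y‖)) + ‖y‖ -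
        (|y.fn t| + |y.der t|) =
        ((|y.fn t| - ‖y‖) ^ 2 + (|y.der t| - ‖y‖) ^ 2) * (1 / (2 * ‖y‖)) := by
      rw [← abs_mul_abs_self (y.fn t), ← abs_mul_abs_self (y.der t)]
      field_simp
      ring
    have a2 : 0 ≤ ((|y.fn t| - ‖y‖) ^ 2 + (|y.der t| - ‖y‖) ^ 2) * (1 / (2 * ‖y‖)) := by
      positivity
    linarith
  rw [intervalIntegral.integral_add (hii.mul_const _) _root_.intervalIntegrable_const,
    intervalIntegral.integral_mul_const, ← norm_sq] at h3
  have h4 : ‖y‖ ^ 2 * (1 / (2 * ‖y‖)) = ‖y‖ / 2 := by field_simp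
  rw [h4] at h3
  simp only [intervalIntegral.integral_const, sub_zero, one_smul] at h3
  linarith

end W21

/-! ### The space `W_2^{-1}[0,1]` and the classes of potentials -/

/-- The space `W_2^{-1}[0,1]`: bounded linear functionals on `W_2^1[0,1]` with the norm
`sup {⟨q, z⟩ : ‖z‖ = 1}` (the completion of `L_2[0,1]` in this norm). -/
abbrev Wneg : Type := StrongDual ℝ W21

/-- A summable function as an element of `W_2^{-1}[0,1]`: `⟨q, z⟩ = ∫₀¹ q z dx`. -/
def ofL1 (q : ℝ → ℝ) (hq : IntervalIntegrable q volume 0 1) : Wneg :=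
  LinearMap.mkContinuous
    { toFun := fun z => ∫ x in (0 : ℝ)..1, q x * z.fn x
      map_add' := fun y z => by
        rw [← intervalIntegral.integral_add
          (hq.mul_continuousOn y.continuous_fn.continuousOn)
          (hq.mul_continuousOn z.continuous_fn.continuousOn)]
        simp only [W21.fn_add, mul_add]
      map_smul' := fun c y => by
        simp only [W21.fn_smul, RingHom.id_apply, smul_eq_mul]
        rw [← intervalIntegral.integral_const_mul]
        congr 1
        funext x
        ring }
    (2 * ∫ x in (0 : ℝ)..1, |q x|)
    (fun z => by
      have h : ‖∫ x in (0 : ℝ)..1, q x * z.fn x‖ ≤ ∫ x in (0 : ℝ)..1, |q x| * (2 * ‖z‖) := by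
        refine (intervalIntegral.norm_integral_le_integral_norm zero_le_one).trans ?_
        refine intervalIntegral.integral_mono_on zero_le_one
          (hq.mul_continuousOn z.continuous_fn.continuousOn).norm (hq.abs.mul_const _)
          fun x hx => ?_
        rw [norm_mul]
        exact mul_le_mul_of_nonneg_left (z.abs_fn_le hx) (abs_nonneg _)
      rw [intervalIntegral.integral_mul_const] at h
      calc _ ≤ _ := h
        _ = _ := by ring)

/-- The Dirac delta function supported at the point `ζ` of `[0,1]`: `⟨δ_ζ, z⟩ = z(ζ)`. -/
def dirac (ζ : I) : Wneg :=
  LinearMap.mkContinuous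
    { toFun := fun z => z.fn ζ
      map_add' := fun _ _ => rfl
      map_smul' := fun _ _ => rfl }
    2 (fun z => z.abs_fn_le ζ.2)

/-- The class `A_1` of the non-negative functions `q ∈ L_1[0,1]` with `∫₀¹ q dx = 1`. -/
def A₁ : Set (ℝ → ℝ) :=
  {q | IntervalIntegrable q volume 0 1 ∧ (∀ᵐ x ∂(volume.restrict (Icc (0 : ℝ) 1)), 0 ≤ q x) ∧
    ∫ x in (0 : ℝ)..1, q x = 1}

/-- The closure `Γ_1` of the class `A_1` in the space `W_2^{-1}[0,1]`. -/
def Γ₁ : Set Wneg := closure {p | ∃ q, ∃ hq : q ∈ A₁, p = ofL1 q hq.1}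

/-! ### Eigenvalue problems -/

/-- `ev` is an eigenvalue of `-y'' + q y = ev y`, `y'(0) - a y(0) = y'(1) + b y(1) = 0`: there is
a non-trivial solution `y ∈ W_1^2[0,1]` (that is, `y` has an absolutely continuous derivative `v`
on `[0,1]`), the equation being satisfied almost everywhere. -/
def IsEigenvalue (a b : ℝ) (q : ℝ → ℝ) (ev : ℝ) : Prop :=
  ∃ y v : ℝ → ℝ,
    (∀ x ∈ Icc (0 : ℝ) 1, HasDerivWithinAt y (v x) (Icc 0 1) x) ∧
    AbsolutelyContinuousOnInterval v 0 1 ∧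
    (∀ᵐ x ∂(volume.restrict (Icc (0 : ℝ) 1)), -deriv v x + q x * y x = ev * y x) ∧
    v 0 - a * y 0 = 0 ∧ v 1 + b * y 1 = 0 ∧
    ∃ x ∈ Icc (0 : ℝ) 1, y x ≠ 0

/-- The value `⟨T_q(ev) y, z⟩` of the operator pencil `T_q` of the boundary value problem
`-y'' + q y = ev y`, `y'(0) - k₀² y(0) = y'(1) + k₁² y(1) = 0` with a generalized potential
`q ∈ W_2^{-1}[0,1]`, where `∫₀¹ q y z dx` stands for `⟨q, y z⟩`. -/
def pencil (k₀ k₁ : ℝ) (q : Wneg) (ev : ℝ) (y z : W21) : ℝ :=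
  (∫ x in (0 : ℝ)..1, (y.der x * z.der x - ev * (y.fn x * z.fn x))) + q (y * z)
    + k₀ ^ 2 * y.fn 0 * z.fn 0 + k₁ ^ 2 * y.fn 1 * z.fn 1

/-- `ev` is an eigenvalue of the pencil `T_q`: the operator `T_q(ev)` has a non-zero kernel. -/
def IsPencilEigenvalue (k₀ k₁ : ℝ) (q : Wneg) (ev : ℝ) : Prop :=
  ∃ y : W21, y ≠ 0 ∧ ∀ z : W21, pencil k₀ k₁ q ev y z = 0

/-- `ev = λ₁(q)` for a generalized potential `q`: the minimal eigenvalue of the pencil `T_q`. -/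
def IsFirstEigenvalue (k₀ k₁ : ℝ) (q : Wneg) (ev : ℝ) : Prop :=
  IsLeast {e | IsPencilEigenvalue k₀ k₁ q e} ev

/-- `m` is the infimum `m_1^-` of the minimal eigenvalues `λ₁(-q)`, where `q` runs over `A_1`. -/
def IsM₁neg (k₀ k₁ m : ℝ) : Prop :=
  IsGLB {ev | ∃ q ∈ A₁, IsLeast {e | IsEigenvalue (k₀ ^ 2) (k₁ ^ 2) (fun x => -q x) e} ev} m

/-- The infimum `m_1^-` equals `m` and is attained at the generalized potential `-p`: the latter
belongs to the extended class `-Γ_1`, its first eigenvalue is `m`, and no potential of this class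
has a smaller first eigenvalue. -/
def M₁negEqAttainedAt (k₀ k₁ m : ℝ) (p : Wneg) : Prop :=
  IsM₁neg k₀ k₁ m ∧ p ∈ Γ₁ ∧ IsFirstEigenvalue k₀ k₁ (-p) m ∧
    ∀ r ∈ Γ₁, ∀ ev, IsFirstEigenvalue k₀ k₁ (-r) ev → m ≤ ev

/-- The problem `-y'' = μ y` on `(0,ζ) ∪ (ζ,1)`,
`y'(0) - k₀² y(0) = 2 y'(ζ-0) - y(ζ) = 2 y'(ζ+0) + y(ζ) = y'(1) + k₁² y(1) = 0`
has a continuous positive solution. -/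
def HasPositiveSolution (k₀ k₁ μ ζ : ℝ) : Prop :=
  ∃ y : ℝ → ℝ, ContinuousOn y (Icc 0 1) ∧ (∀ x ∈ Icc (0 : ℝ) 1, 0 < y x) ∧
    (∀ x ∈ Ioo 0 ζ ∪ Ioo ζ 1, DifferentiableAt ℝ y x ∧ HasDerivAt (deriv y) (-(μ * y x)) x) ∧
    ∃ d₀ dl dr d₁ : ℝ,
      Tendsto (deriv y) (𝓝[>] 0) (𝓝 d₀) ∧ Tendsto (deriv y) (𝓝[<] ζ) (𝓝 dl) ∧
      Tendsto (deriv y) (𝓝[>] ζ) (𝓝 dr) ∧ Tendsto (deriv y) (𝓝[<] 1) (𝓝 d₁) ∧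
      d₀ - k₀ ^ 2 * y 0 = 0 ∧ 2 * dl - y ζ = 0 ∧ 2 * dr + y ζ = 0 ∧ d₁ + k₁ ^ 2 * y 1 = 0

end SturmDelta

end

open SturmDelta

/-!
Write `a = k₀²`, `b = k₁²`. For a non-negative potential `q` of mass one, `∫ q z² ≤ max z²`, so the
extremal problem reduces to the potentials `-δ_ξ`: a number `m` is a lower bound for all the first
eigenvalues as soon as `z(ξ)² ≤ ∫ (z'² - m z²) + a z(0)² + b z(1)²` for all `z` and `ξ`
(`DominatesDeltas`). This passes to the closure `Γ₁`, because `r ↦ ⟨r, z²⟩` is continuous. If in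
addition `m` belongs to a positive eigenfunction for `-δ_ζ` (`IsGroundState`), then `m` is attained
at `-δ_ζ` (`IsGroundState.m₁negEqAttainedAt`).

That `m` is the greatest lower bound requires potentials of class `A_1` which possess a first
eigenvalue close to `m`. They are obtained from a function `W` rather than by an existence theorem: if
`W(0) = a`, `W(1) = -b`, then `q = -W' - W² - λ` has the positive eigenfunction `exp ∫ W` with the
eigenvalue `λ`, which is the first one by Picone's inequality (`isLeast_of_riccati`). A suitable `W`
arises from the logarithmic derivative of the ground state by a perturbation that makes room below
mass one, and by smoothing the jump at `ζ` (`IsGroundState.exists_mem_A₁`).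

The inequality of `DominatesDeltas` follows from Picone's inequality, once there is for every `ξ` a
function `W` with `W' + W² ≤ -m`, the boundary values `a` and `-b`, and a downward jump `1` at `ξ`. Let
`w = y'/y` for the ground state `y`, so that `w' = -(y'² + m y²) / y²`, where the numerator is constant
on either side of `ζ`. If it is non-negative, then `w` decreases, `w ≥ 1/2` on the left and
`w ≤ -1/2` on the right of `ζ`, and the jump can be moved to `ξ` by taking `w - 1` or `w + 1` between
the points (`IsGroundState.dominatesDeltas`). This covers the inner points `ζ`, where `μ ≥ -k₀⁴` gives
the sign, and a part of the case `ζ = 0`. In the rest of that case `-w` is decreasing and concave, and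
a reflection of `w` provides `W` (`dominatesDeltas_of_monotoneOn`).

Finally, solutions with prescribed values of `r = -y'/y` at the end points exist because `r' = μ + r²`
passes from `r₀` to `r₁` in the time `∫ ds / (μ + s²)`, which takes the value one for some `μ`
(`exists_solution_of_integral_eq`, `exists_integral_inv_add_eq_one`). In this way a positive solution
with an inner point `ζ` is found whenever `a > 1/2`, so that only `a ≤ 1/2` remains for `ζ = 0`.
-/

namespace SturmDelta

/-! ### Integrals and Lipschitz functions on intervals -/

theorem integral_mono_of_ae_Ioo {c d : ℝ} {f g : ℝ → ℝ} (hcd : c ≤ d)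
    (hf : IntervalIntegrable f volume c d) (hg : IntervalIntegrable g volume c d)
    (h : ∀ᵐ x : ℝ, x ∈ Ioo c d → f x ≤ g x) : ∫ x in c..d, f x ≤ ∫ x in c..d, g x := by
  refine intervalIntegral.integral_mono_ae_restrict hcd hf hg ?_
  rw [← Measure.restrict_congr_set Ioo_ae_eq_Icc]
  exact (ae_restrict_iff' measurableSet_Ioo).2 h

theorem integral_congr_of_ae_Ioo {c d : ℝ} {f g : ℝ → ℝ} (hcd : c ≤ d)
    (h : ∀ᵐ x : ℝ, x ∈ Ioo c d → f x = g x) : ∫ x in c..d, f x = ∫ x in c..d, g x := by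
  refine intervalIntegral.integral_congr_ae_restrict ?_
  rw [uIoc_of_le hcd, ← Measure.restrict_congr_set Ioo_ae_eq_Ioc]
  exact (ae_restrict_iff' measurableSet_Ioo).2 h

theorem ae_Ioo_of_ae_restrict {c d : ℝ} {p : ℝ → Prop}
    (h : ∀ᵐ x ∂(volume.restrict (Icc c d)), p x) : ∀ᵐ x : ℝ, x ∈ Ioo c d → p x := by
  filter_upwards [(ae_restrict_iff' measurableSet_Icc).1 h] with x hx hx'
  exact hx (Ioo_subset_Icc_self hx')

theorem ae_restrict_of_ae_Ioo {c d : ℝ} {p : ℝ → Prop}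
    (h : ∀ᵐ x : ℝ, x ∈ Ioo c d → p x) : ∀ᵐ x ∂(volume.restrict (Icc c d)), p x := by
  rw [← Measure.restrict_congr_set Ioo_ae_eq_Icc]
  exact (ae_restrict_iff' measurableSet_Ioo).2 h

theorem exists_lipschitzOnWith {f f' : ℝ → ℝ} {c d : ℝ}
    (hf : ∀ x ∈ Icc c d, HasDerivWithinAt f (f' x) (Icc c d) x)
    (hc : ContinuousOn f' (Icc c d)) : ∃ K, LipschitzOnWith K f (Icc c d) := by
  obtain ⟨C, hC⟩ := isCompact_Icc.exists_bound_of_continuousOn hc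
  refine ⟨C.toNNReal, (convex_Icc c d).lipschitzOnWith_of_nnnorm_hasDerivWithin_le hf fun x hx => ?_⟩
  rw [← NNReal.coe_le_coe, coe_nnnorm]
  exact (hC x hx).trans (Real.le_coe_toNNReal C)

theorem absolutelyContinuous_of_hasDerivWithinAt {f f' : ℝ → ℝ} {c d : ℝ} (hcd : c ≤ d)
    (hf : ∀ x ∈ Icc c d, HasDerivWithinAt f (f' x) (Icc c d) x)
    (hc : ContinuousOn f' (Icc c d)) : AbsolutelyContinuousOnInterval f c d := by
  obtain ⟨K, hK⟩ := exists_lipschitzOnWith hf hc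
  refine LipschitzOnWith.absolutelyContinuousOnInterval (K := K) ?_
  rwa [uIcc_of_le hcd]

theorem exists_lipschitzOnWith_union {f : ℝ → ℝ} {c e d : ℝ}
    (h1 : ∃ K, LipschitzOnWith K f (Icc c e)) (h2 : ∃ K, LipschitzOnWith K f (Icc e d)) :
    ∃ K, LipschitzOnWith K f (Icc c d) := by
  obtain ⟨K1, h1⟩ := h1
  obtain ⟨K2, h2⟩ := h2
  refine ⟨max K1 K2, LipschitzOnWith.of_dist_le_mul ?_⟩
  have k1 : (K1 : ℝ) ≤ (max K1 K2 : NNReal) := by exact_mod_cast le_max_left K1 K2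
  have k2 : (K2 : ℝ) ≤ (max K1 K2 : NNReal) := by exact_mod_cast le_max_right K1 K2
  have a1 : ∀ x ∈ Icc c e, ∀ y ∈ Icc c e, |f x - f y| ≤ (max K1 K2 : NNReal) * |x - y| :=
    fun x hx y hy => (h1.dist_le_mul x hx y hy).trans
      (mul_le_mul_of_nonneg_right k1 (abs_nonneg _))
  have a2 : ∀ x ∈ Icc e d, ∀ y ∈ Icc e d, |f x - f y| ≤ (max K1 K2 : NNReal) * |x - y| :=
    fun x hx y hy => (h2.dist_le_mul x hx y hy).trans
      (mul_le_mul_of_nonneg_right k2 (abs_nonneg _))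
  have a3 : ∀ x y, x ∈ Icc c e → y ∈ Icc e d →
      |f x - f y| ≤ (max K1 K2 : NNReal) * |x - y| := by
    intro x y hx hy
    have b1 := a1 x hx e ⟨hx.1.trans hx.2, le_rfl⟩
    have b2 := a2 e ⟨le_rfl, hy.1.trans hy.2⟩ y hy
    have b3 := abs_sub_le (f x) (f e) (f y)
    rw [abs_of_nonpos (sub_nonpos.2 hx.2)] at b1
    rw [abs_of_nonpos (sub_nonpos.2 hy.1)] at b2
    rw [abs_of_nonpos (sub_nonpos.2 (hx.2.trans hy.1))]
    linarith
  intro x hx y hy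
  simp only [Real.dist_eq]
  rcases le_total x e with hxe | hxe <;> rcases le_total y e with hye | hye
  · exact a1 x ⟨hx.1, hxe⟩ y ⟨hy.1, hye⟩
  · exact a3 x y ⟨hx.1, hxe⟩ ⟨hye, hy.2⟩
  · rw [abs_sub_comm, abs_sub_comm x y]
    exact a3 y x ⟨hy.1, hye⟩ ⟨hxe, hx.2⟩
  · exact a2 x ⟨hxe, hx.2⟩ y ⟨hye, hy.2⟩

/-! ### Functions of class `W_2^1[0,1]` -/

namespace W21

theorem ac (z : W21) {c d : ℝ} (hc : 0 ≤ c) (hcd : c ≤ d) (hd : d ≤ 1) :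
    AbsolutelyContinuousOnInterval z.fn c d := by
  refine AbsolutelyContinuousOnInterval.mono (a := 0) (b := 1) z.2.1 ?_
  rw [uIcc_of_le hcd, uIcc_of_le zero_le_one]
  exact Icc_subset_Icc hc hd

theorem ae_hasDerivAt (z : W21) : ∀ᵐ x : ℝ, x ∈ Ioo (0 : ℝ) 1 → HasDerivAt z.fn (z.der x) x := by
  have h : AbsolutelyContinuousOnInterval z.fn 0 1 := z.2.1
  filter_upwards [h.ae_differentiableAt] with x hx hx'
  exact (hx (by rw [uIcc_of_le zero_le_one]; exact Ioo_subset_Icc_self hx')).hasDerivAt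

theorem intervalIntegrable_der_sq (z : W21) {c d : ℝ} (hc : 0 ≤ c) (hcd : c ≤ d) (hd : d ≤ 1) :
    IntervalIntegrable (fun x => z.der x ^ 2) volume c d := by
  rw [intervalIntegrable_iff_integrableOn_Ioc_of_le hcd]
  have h := integrable_der z z
  refine (IntegrableOn.mono_set h (Ioc_subset_Ioc hc hd)).congr_fun (fun x _ => ?_)
    measurableSet_Ioc
  simp only [sq]

theorem intervalIntegrable_mul_sq (z : W21) {p : ℝ → ℝ} {c d : ℝ}
    (hp : IntervalIntegrable p volume c d) :
    IntervalIntegrable (fun x => p x * z.fn x ^ 2) volume c d :=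
  hp.mul_continuousOn (z.continuous_fn.pow 2).continuousOn

theorem intervalIntegrable_energy (z : W21) {p : ℝ → ℝ} {c d : ℝ} (hc : 0 ≤ c) (hcd : c ≤ d)
    (hd : d ≤ 1) (hp : IntervalIntegrable p volume c d) :
    IntervalIntegrable (fun x => z.der x ^ 2 + p x * z.fn x ^ 2) volume c d :=
  (z.intervalIntegrable_der_sq hc hcd hd).add (z.intervalIntegrable_mul_sq hp)

theorem eq_zero_of_fn {z : W21} (h : ∀ x ∈ Icc (0 : ℝ) 1, z.fn x = 0) : z = 0 := by
  refine Subtype.ext ?_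
  funext t
  have h3 : z.1 t = 0 := by simpa [fn, ext] using h t t.2
  exact h3

theorem integral_sq_pos {z : W21} (hz : z ≠ 0) : 0 < ∫ x in (0 : ℝ)..1, z.fn x ^ 2 := by
  obtain ⟨x, hx, hx0⟩ : ∃ x ∈ Icc (0 : ℝ) 1, z.fn x ≠ 0 := by
    by_contra! h
    exact hz (eq_zero_of_fn h)
  exact intervalIntegral.integral_pos zero_lt_one (z.continuous_fn.pow 2).continuousOn
    (fun _ _ => sq_nonneg _) ⟨x, hx, by positivity⟩

/-- A Lipschitz function on `[0,1]` is of class `W_2^1[0,1]`, its derivative being any function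
that is its derivative almost everywhere. -/
theorem exists_of_lipschitz {f V : ℝ → ℝ} (hf : ∃ K, LipschitzOnWith K f (Icc 0 1))
    (hd : ∀ᵐ x : ℝ, x ∈ Ioo (0 : ℝ) 1 → HasDerivAt f (V x) x) :
    ∃ z : W21, (∀ x ∈ Icc (0 : ℝ) 1, z.fn x = f x) ∧
      ∀ᵐ x : ℝ, x ∈ Ioo (0 : ℝ) 1 → z.der x = V x := by
  obtain ⟨K, hf⟩ := hf
  set y : I → ℝ := fun t => f t with hy
  have e : ∀ x ∈ Icc (0 : ℝ) 1, ext y x = f x := by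
    intro x hx
    simp [ext, hy, IccExtend, projIcc_of_mem zero_le_one hx]
  have hl : LipschitzWith K (ext y) := by
    refine LipschitzWith.of_dist_le_mul fun s t => ?_
    have h1 := hf.dist_le_mul _ (projIcc (0 : ℝ) 1 zero_le_one s).2 _
      (projIcc (0 : ℝ) 1 zero_le_one t).2
    refine h1.trans (mul_le_mul_of_nonneg_left ?_ K.2)
    exact (LipschitzWith.projIcc zero_le_one).dist_le_mul s t |>.trans (by simp)
  have hm : MemW21 y := by
    refine ⟨hl.lipschitzOnWith.absolutelyContinuousOnInterval, ?_⟩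
    refine MemLp.of_bound (measurable_deriv _).aestronglyMeasurable (K : ℝ)
      (Eventually.of_forall fun x => norm_deriv_le_of_lipschitz hl)
  refine ⟨⟨y, hm⟩, e, ?_⟩
  filter_upwards [hd] with x hx hx'
  have h2 : ext y =ᶠ[𝓝 x] f := by
    filter_upwards [Ioo_mem_nhds hx'.1 hx'.2] with t ht
    exact e t (Ioo_subset_Icc_self ht)
  exact ((hx hx').congr_of_eventuallyEq h2).deriv

end W21

/-! ### Picone's inequality -/

/-- Picone's inequality: a solution `W` of the Riccati inequality `W' + W² ≤ p` bounds the energy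
`∫ (z'² + p z²)` from below by boundary terms, because `(z' - W z)² ≥ 0`. -/
theorem picone (z : W21) {c d : ℝ} (hc : 0 ≤ c) (hcd : c ≤ d) (hd : d ≤ 1) {W p : ℝ → ℝ}
    (hW : AbsolutelyContinuousOnInterval W c d) (hp : IntervalIntegrable p volume c d)
    (h : ∀ᵐ x : ℝ, x ∈ Ioo c d → deriv W x + W x ^ 2 ≤ p x) :
    W d * z.fn d ^ 2 - W c * z.fn c ^ 2 ≤ ∫ x in c..d, (z.der x ^ 2 + p x * z.fn x ^ 2) := by
  have hz := z.ac hc hcd hd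
  have hF := hW.mul (hz.mul hz)
  have e := hF.integral_deriv_eq_sub
  have e' : W d * z.fn d ^ 2 - W c * z.fn c ^ 2 =
      ∫ x in c..d, deriv (W * (z.fn * z.fn)) x := by
    rw [e]
    simp only [Pi.mul_apply]
    ring
  rw [e']
  refine integral_mono_of_ae_Ioo hcd hF.intervalIntegrable_deriv
    (z.intervalIntegrable_energy hc hcd hd hp) ?_
  filter_upwards [hW.ae_differentiableAt, z.ae_hasDerivAt, h] with x h1 h2 h3 hx
  have h1 := (h1 (by rw [uIcc_of_le hcd]; exact Ioo_subset_Icc_self hx)).hasDerivAt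
  have h2 := h2 ⟨hc.trans_lt hx.1, hx.2.trans_le hd⟩
  rw [(h1.mul (h2.mul h2)).deriv]
  simp only [Pi.mul_apply]
  nlinarith [sq_nonneg (z.der x - W x * z.fn x),
    mul_le_mul_of_nonneg_right (h3 hx) (sq_nonneg (z.fn x))]

/-- Picone's inequality for a continuously differentiable `W` and a constant `p = -μ`. -/
theorem picone_of_hasDerivWithinAt (z : W21) {c d μ : ℝ} (hc : 0 ≤ c) (hcd : c ≤ d) (hd : d ≤ 1)
    {W W' : ℝ → ℝ} (hW : ∀ x ∈ Icc c d, HasDerivWithinAt W (W' x) (Icc c d) x)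
    (hW' : ContinuousOn W' (Icc c d)) (h : ∀ x ∈ Ioo c d, W' x + W x ^ 2 ≤ -μ) :
    W d * z.fn d ^ 2 - W c * z.fn c ^ 2 ≤ ∫ x in c..d, (z.der x ^ 2 + -μ * z.fn x ^ 2) := by
  refine picone z hc hcd hd (absolutelyContinuous_of_hasDerivWithinAt hcd hW hW')
    _root_.intervalIntegrable_const (Eventually.of_forall fun x hx => ?_)
  rw [((hW x (Ioo_subset_Icc_self hx)).hasDerivAt (Icc_mem_nhds hx.1 hx.2)).deriv]
  exact h x hx

/-- The energy `∫₀¹ (z'² + p z²) dx + a z(0)² + b z(1)²` of a Sturm–Liouville problem with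
boundary conditions `y'(0) - a y(0) = y'(1) + b y(1) = 0`. -/
noncomputable def energy (a b : ℝ) (p : ℝ → ℝ) (z : W21) : ℝ :=
  (∫ x in (0 : ℝ)..1, (z.der x ^ 2 + p x * z.fn x ^ 2)) + a * z.fn 0 ^ 2 + b * z.fn 1 ^ 2

theorem energy_add_const {a b : ℝ} {p : ℝ → ℝ} (hp : IntervalIntegrable p volume 0 1) (c : ℝ)
    (z : W21) : energy a b (fun x => p x + c) z =
      energy a b p z + c * ∫ x in (0 : ℝ)..1, z.fn x ^ 2 := by
  have h1 := z.intervalIntegrable_energy le_rfl zero_le_one le_rfl hp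
  have h2 : IntervalIntegrable (fun x => c * z.fn x ^ 2) volume 0 1 :=
    ((z.continuous_fn.pow 2).const_smul c).intervalIntegrable 0 1
  have e : ∫ x in (0 : ℝ)..1, (z.der x ^ 2 + (p x + c) * z.fn x ^ 2) =
      (∫ x in (0 : ℝ)..1, (z.der x ^ 2 + p x * z.fn x ^ 2)) +
        c * ∫ x in (0 : ℝ)..1, z.fn x ^ 2 := by
    rw [← intervalIntegral.integral_const_mul, ← intervalIntegral.integral_add h1 h2]
    congr 1
    funext x
    ring
  simp only [energy, e]
  ring

theorem energy_nonneg {a b : ℝ} {W p : ℝ → ℝ} (hW : AbsolutelyContinuousOnInterval W 0 1)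
    (hp : IntervalIntegrable p volume 0 1)
    (h : ∀ᵐ x : ℝ, x ∈ Ioo (0 : ℝ) 1 → deriv W x + W x ^ 2 ≤ p x) (h0 : W 0 = a) (h1 : W 1 = -b)
    (z : W21) : 0 ≤ energy a b p z := by
  have := picone z le_rfl zero_le_one le_rfl hW hp h
  rw [h0, h1] at this
  unfold energy
  linarith

/-! ### Eigenvalues of problems with summable potentials -/

theorem exists_energy_eq_zero_of_isEigenvalue {a b ev : ℝ} {Q : ℝ → ℝ}
    (h : IsEigenvalue a b Q ev) :
    ∃ z : W21, z ≠ 0 ∧ energy a b (fun x => Q x - ev) z = 0 := by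
  obtain ⟨y, v, hy, hv, heq, h0, h1, x₀, hx₀, hne⟩ := h
  have hvc : ContinuousOn v (Icc 0 1) := by
    have := hv.continuousOn
    rwa [uIcc_of_le zero_le_one] at this
  obtain ⟨z, hz, hz'⟩ := W21.exists_of_lipschitz (V := v) (exists_lipschitzOnWith hy hvc)
    (Eventually.of_forall fun x hx =>
      (hy x (Ioo_subset_Icc_self hx)).hasDerivAt (Icc_mem_nhds hx.1 hx.2))
  refine ⟨z, fun h => hne ?_, ?_⟩
  · rw [← hz x₀ hx₀, h]
    rfl
  have hF := hv.mul (absolutelyContinuous_of_hasDerivWithinAt zero_le_one hy hvc)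
  have e : ∫ x in (0 : ℝ)..1, (z.der x ^ 2 + (Q x - ev) * z.fn x ^ 2) = v 1 * y 1 - v 0 * y 0 := by
    have e1 := hF.integral_deriv_eq_sub
    simp only [Pi.mul_apply] at e1
    rw [← e1]
    refine integral_congr_of_ae_Ioo zero_le_one ?_
    filter_upwards [hv.ae_differentiableAt, hz', ae_Ioo_of_ae_restrict heq] with x a1 a2 a3 hx
    have hx' := Ioo_subset_Icc_self hx
    have a1 := (a1 (by rwa [uIcc_of_le zero_le_one])).hasDerivAt
    rw [(a1.mul ((hy x hx').hasDerivAt (Icc_mem_nhds hx.1 hx.2))).deriv, a2 hx, hz x hx']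
    linear_combination y x * a3 hx
  unfold energy
  rw [e, hz 0 ⟨le_rfl, zero_le_one⟩, hz 1 ⟨zero_le_one, le_rfl⟩]
  linear_combination y 1 * h1 - y 0 * h0

/-- A solution `W` of the Riccati equation matching the boundary conditions is the logarithmic
derivative of a positive eigenfunction, and the eigenvalue of the latter is minimal by Picone's
inequality. -/
theorem isLeast_of_riccati {a b ev : ℝ} {W Q : ℝ → ℝ} (hW : AbsolutelyContinuousOnInterval W 0 1)
    (hQ : IntervalIntegrable Q volume 0 1)
    (h : ∀ᵐ x : ℝ, x ∈ Ioo (0 : ℝ) 1 → deriv W x + W x ^ 2 = Q x - ev)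
    (h0 : W 0 = a) (h1 : W 1 = -b) : IsLeast {e | IsEigenvalue a b Q e} ev := by
  constructor
  · have hWc : ContinuousOn W (Icc 0 1) := by
      have := hW.continuousOn
      rwa [uIcc_of_le zero_le_one] at this
    set Wc : ℝ → ℝ := IccExtend (zero_le_one' ℝ) ((Icc (0 : ℝ) 1).domRestrict W) with hWcd
    have hcont : Continuous Wc := (continuousOn_iff_continuous_domRestrict.1 hWc).Icc_extend'
    have hWe : ∀ x ∈ Icc (0 : ℝ) 1, Wc x = W x := fun x hx => by
      simp [hWcd, IccExtend, projIcc_of_mem zero_le_one hx]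
    set y : ℝ → ℝ := fun x => Real.exp (∫ t in (0 : ℝ)..x, Wc t) with hy
    have hder : ∀ x, HasDerivAt y (Wc x * y x) x := fun x => by
      have := (hcont.integral_hasStrictDerivAt 0 x).hasDerivAt.exp
      rwa [mul_comm] at this
    have hyw : ∀ x ∈ Icc (0 : ℝ) 1, HasDerivWithinAt y (W x * y x) (Icc 0 1) x := fun x hx => by
      rw [← hWe x hx]
      exact (hder x).hasDerivWithinAt
    have hyc : ContinuousOn y (Icc 0 1) := fun x hx => (hyw x hx).continuousWithinAt
    refine ⟨y, fun x => W x * y x, hyw, hW.mul (absolutelyContinuous_of_hasDerivWithinAt zero_le_one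
      hyw (hWc.mul hyc)), ae_restrict_of_ae_Ioo ?_, by simp [h0], by simp [h1], 0,
      ⟨le_rfl, zero_le_one⟩, (Real.exp_pos _).ne'⟩
    filter_upwards [hW.ae_differentiableAt, h] with x a1 a2 hx
    have hx' := Ioo_subset_Icc_self hx
    have a1 := (a1 (by rwa [uIcc_of_le zero_le_one])).hasDerivAt
    have a3 := hder x
    rw [hWe x hx'] at a3
    have : deriv (fun x => W x * y x) x = _ := (a1.mul a3).deriv
    rw [this]
    linear_combination -y x * a2 hx
  · intro e he
    obtain ⟨z, hz, hE⟩ := exists_energy_eq_zero_of_isEigenvalue he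
    have hp : IntervalIntegrable (fun x => Q x - e) volume 0 1 :=
      hQ.sub _root_.intervalIntegrable_const
    have h2 := energy_nonneg (p := fun x => Q x - ev) hW (hQ.sub _root_.intervalIntegrable_const)
      (by filter_upwards [h] with x hx hx' using (hx hx').le) h0 h1 z
    have h3 := energy_add_const (a := a) (b := b) hp (e - ev) z
    have h4 : (fun x => Q x - e + (e - ev)) = fun x => Q x - ev := by
      funext x
      ring
    rw [h4, hE, zero_add] at h3
    rw [h3] at h2
    have := W21.integral_sq_pos hz
    nlinarith

/-- A solution of a Riccati inequality of total mass at most one is turned into a potential of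
class `A_1` by adding the missing mass as a constant, which only lowers the eigenvalue. -/
theorem exists_mem_A₁_of_riccati {a b ev : ℝ} {W : ℝ → ℝ}
    (hW : AbsolutelyContinuousOnInterval W 0 1)
    (h : ∀ᵐ x : ℝ, x ∈ Ioo (0 : ℝ) 1 → deriv W x + W x ^ 2 ≤ -ev)
    (h0 : W 0 = a) (h1 : W 1 = -b) (hm : a + b - (∫ x in (0 : ℝ)..1, W x ^ 2) - ev ≤ 1) :
    ∃ q ∈ A₁, ∃ e ≤ ev, IsLeast {e | IsEigenvalue a b (fun x => -q x) e} e := by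
  set s : ℝ := 1 - (a + b - (∫ x in (0 : ℝ)..1, W x ^ 2) - ev) with hs
  have i1 : IntervalIntegrable (deriv W) volume 0 1 := hW.intervalIntegrable_deriv
  have i2 : IntervalIntegrable (fun x => W x ^ 2) volume 0 1 :=
    (hW.continuousOn.pow 2).intervalIntegrable
  have i3 : IntervalIntegrable (fun x => deriv W x + W x ^ 2) volume 0 1 := i1.add i2
  have iq : IntervalIntegrable (fun x => -(deriv W x + W x ^ 2) + (s - ev)) volume 0 1 :=
    i3.neg.add _root_.intervalIntegrable_const
  refine ⟨fun x => -(deriv W x + W x ^ 2) + (s - ev), ⟨iq, ae_restrict_of_ae_Ioo ?_, ?_⟩,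
    ev - s, by linarith, isLeast_of_riccati hW iq.neg ?_ h0 h1⟩
  · filter_upwards [h] with x hx hx'
    linarith [hx hx']
  · have e1 : ∫ x in (0 : ℝ)..1, deriv W x = W 1 - W 0 := hW.integral_deriv_eq_sub
    have e2 : ∫ x in (0 : ℝ)..1, (-(deriv W x + W x ^ 2) + (s - ev)) =
        (∫ x in (0 : ℝ)..1, -(deriv W x + W x ^ 2)) + ∫ x in (0 : ℝ)..1, (s - ev) :=
      intervalIntegral.integral_add i3.neg _root_.intervalIntegrable_const
    rw [e2, intervalIntegral.integral_neg, intervalIntegral.integral_add i1 i2, e1, h0, h1,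
      intervalIntegral.integral_const]
    simp only [sub_zero, one_smul]
    linarith
  · refine Eventually.of_forall fun x _ => ?_
    ring

/-! ### The extended class of potentials -/

theorem ofL1_apply (q : ℝ → ℝ) (hq : IntervalIntegrable q volume 0 1) (z : W21) :
    ofL1 q hq z = ∫ x in (0 : ℝ)..1, q x * z.fn x := rfl

theorem dirac_apply (ζ : I) (z : W21) : dirac ζ z = z.fn ζ := rfl

theorem integral_mul_sq_le_of_mem_A₁ {q : ℝ → ℝ} (hq : q ∈ A₁) {z : W21} {M : ℝ}
    (hM : ∀ x ∈ Icc (0 : ℝ) 1, z.fn x ^ 2 ≤ M) : ∫ x in (0 : ℝ)..1, q x * z.fn x ^ 2 ≤ M := by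
  calc ∫ x in (0 : ℝ)..1, q x * z.fn x ^ 2 ≤ ∫ x in (0 : ℝ)..1, q x * M := by
        refine integral_mono_of_ae_Ioo zero_le_one (z.intervalIntegrable_mul_sq hq.1)
          (hq.1.mul_const M) ?_
        filter_upwards [ae_Ioo_of_ae_restrict hq.2.1] with x hx hx'
        exact mul_le_mul_of_nonneg_left (hM x (Ioo_subset_Icc_self hx')) (hx hx')
    _ = M := by rw [intervalIntegral.integral_mul_const, hq.2.2, one_mul]

theorem apply_mul_self_le_of_mem_Γ₁ {r : Wneg} (hr : r ∈ Γ₁) {z : W21} {M : ℝ}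
    (hM : ∀ x ∈ Icc (0 : ℝ) 1, z.fn x ^ 2 ≤ M) : r (z * z) ≤ M := by
  have hcl : IsClosed {r : Wneg | r (z * z) ≤ M} :=
    isClosed_le ((ContinuousLinearMap.apply ℝ ℝ (z * z)).continuous) continuous_const
  refine closure_minimal ?_ hcl hr
  rintro p ⟨q, hq, rfl⟩
  have := integral_mul_sq_le_of_mem_A₁ hq hM
  have e : ofL1 q hq.1 (z * z) = ∫ x in (0 : ℝ)..1, q x * z.fn x ^ 2 := by
    rw [ofL1_apply]
    congr 1
    funext x
    rw [W21.fn_mul, sq]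
  exact e.trans_le this

theorem W21.abs_sub_le (z : W21) {s t ε : ℝ} (hs : 0 ≤ s) (hst : s ≤ t) (ht : t ≤ 1) (hε : 0 < ε)
    (h : t - s ≤ ε ^ 2) : |z.fn t - z.fn s| ≤ ε * ‖z‖ := by
  rcases eq_or_ne z 0 with rfl | hz
  · have : ∀ x, (0 : W21).fn x = 0 := fun _ => rfl
    simp [this]
  have hn : 0 < ‖z‖ := norm_pos_iff.mpr hz
  have i1 := (z.ac hs hst ht).intervalIntegrable_deriv
  have i2 := z.intervalIntegrable_der_sq hs hst ht
  have e1 : ∫ x in s..t, z.der x = z.fn t - z.fn s := (z.ac hs hst ht).integral_deriv_eq_sub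
  have e2 : ∫ x in s..t, z.der x ^ 2 ≤ ‖z‖ ^ 2 := by
    calc ∫ x in s..t, z.der x ^ 2 ≤ ∫ x in (0 : ℝ)..1, z.der x ^ 2 :=
          intervalIntegral.integral_mono_interval hs hst ht
            (Eventually.of_forall fun _ => sq_nonneg _)
            (z.intervalIntegrable_der_sq le_rfl zero_le_one le_rfl)
      _ ≤ ∫ x in (0 : ℝ)..1, (z.fn x * z.fn x + z.der x * z.der x) := by
          refine intervalIntegral.integral_mono_on zero_le_one
            (z.intervalIntegrable_der_sq le_rfl zero_le_one le_rfl) ?_ fun x _ => ?_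
          · rw [intervalIntegrable_iff_integrableOn_Ioc_of_le zero_le_one]
            exact W21.integrable_inner z z
          · nlinarith [sq_nonneg (z.fn x)]
      _ = ‖z‖ ^ 2 := (W21.norm_sq z).symm
  rw [← e1]
  -- the weights in `|z'| ≤ ε z'² / (2 ‖z‖) + ‖z‖ / (2 ε)` balance the two terms
  calc |∫ x in s..t, z.der x| ≤ ∫ x in s..t, |z.der x| :=
        intervalIntegral.abs_integral_le_integral_abs hst
    _ ≤ ∫ x in s..t, (ε / (2 * ‖z‖) * z.der x ^ 2 + ‖z‖ / (2 * ε)) := by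
        refine intervalIntegral.integral_mono_on hst i1.abs
          ((i2.const_mul _).add _root_.intervalIntegrable_const) fun x _ => ?_
        have : ε / (2 * ‖z‖) * z.der x ^ 2 + ‖z‖ / (2 * ε) - |z.der x| =
            (ε * |z.der x| - ‖z‖) ^ 2 / (2 * ε * ‖z‖) := by
          rw [← sq_abs (z.der x)]
          field_simp
          ring
        have h2 : 0 ≤ (ε * |z.der x| - ‖z‖) ^ 2 / (2 * ε * ‖z‖) := by positivity
        linarith
    _ = ε / (2 * ‖z‖) * (∫ x in s..t, z.der x ^ 2) + (t - s) * (‖z‖ / (2 * ε)) := by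
        rw [intervalIntegral.integral_add (i2.const_mul _) _root_.intervalIntegrable_const,
          intervalIntegral.integral_const_mul, intervalIntegral.integral_const, smul_eq_mul]
    _ ≤ ε / (2 * ‖z‖) * ‖z‖ ^ 2 + ε ^ 2 * (‖z‖ / (2 * ε)) := by gcongr
    _ = ε * ‖z‖ := by
        field_simp
        ring

theorem integral_indicator_Ioc {s t : ℝ} (hs : 0 ≤ s) (hst : s ≤ t) (ht : t ≤ 1) (f : ℝ → ℝ) :
    ∫ x in (0 : ℝ)..1, (Ioc s t).indicator f x = ∫ x in s..t, f x := by
  rw [intervalIntegral.integral_of_le zero_le_one, setIntegral_indicator measurableSet_Ioc,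
    inter_eq_self_of_subset_right (Ioc_subset_Ioc hs ht), intervalIntegral.integral_of_le hst]

/-- The delta function is the limit of the uniform distributions on the intervals
`[ζ, ζ + h]`. -/
theorem dirac_mem_Γ₁ {ζ : I} (hζ : (ζ : ℝ) < 1) : dirac ζ ∈ Γ₁ := by
  refine Metric.mem_closure_iff.2 fun ε hε => ?_
  set h : ℝ := min (1 - ζ) ((ε / 2) ^ 2) with hh
  have hpos : 0 < h := lt_min (by linarith) (by positivity)
  have h1 : (ζ : ℝ) + h ≤ 1 := by linarith [min_le_left (1 - (ζ : ℝ)) ((ε / 2) ^ 2)]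
  have h2 : h ≤ (ε / 2) ^ 2 := min_le_right _ _
  have h0 : (0 : ℝ) ≤ ζ := ζ.2.1
  have hle : (ζ : ℝ) ≤ ζ + h := by linarith
  set q : ℝ → ℝ := (Ioc (ζ : ℝ) (ζ + h)).indicator fun _ => h⁻¹ with hq
  have iq : IntervalIntegrable q volume 0 1 := by
    rw [intervalIntegrable_iff_integrableOn_Ioc_of_le zero_le_one]
    exact (integrableOn_const (by simp)).indicator measurableSet_Ioc
  have hqA : q ∈ A₁ := by
    refine ⟨iq, Eventually.of_forall fun x => ?_, ?_⟩
    · exact indicator_nonneg (fun _ _ => by positivity) x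
    · rw [hq, integral_indicator_Ioc h0 hle h1, intervalIntegral.integral_const, smul_eq_mul]
      field_simp
      ring
  refine ⟨ofL1 q iq, ⟨q, hqA, rfl⟩, ?_⟩
  rw [dist_comm, dist_eq_norm]
  refine (ContinuousLinearMap.opNorm_le_bound _ (by positivity : 0 ≤ ε / 2) fun z => ?_).trans_lt
    (half_lt_self hε)
  have ic : ∀ c d, IntervalIntegrable (fun x => h⁻¹ * z.fn x) volume c d := fun c d =>
    (continuous_const.mul z.continuous_fn).intervalIntegrable c d
  have e1 : ∫ x in (0 : ℝ)..1, q x * z.fn x = ∫ x in (ζ : ℝ)..(ζ + h), h⁻¹ * z.fn x := by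
    rw [← integral_indicator_Ioc h0 hle h1]
    congr 1
    funext x
    by_cases hx : x ∈ Ioc (ζ : ℝ) (ζ + h) <;> simp [hq, hx]
  have e2 : z.fn ζ = ∫ x in (ζ : ℝ)..(ζ + h), h⁻¹ * z.fn ζ := by
    rw [intervalIntegral.integral_const, smul_eq_mul]
    field_simp
    ring
  have e3 : (ofL1 q iq - dirac ζ) z = ∫ x in (ζ : ℝ)..(ζ + h), h⁻¹ * (z.fn x - z.fn ζ) := by
    simp only [mul_sub]
    rw [intervalIntegral.integral_sub (ic _ _) _root_.intervalIntegrable_const, ← e2, ← e1]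
    rfl
  rw [e3]
  have e4 := intervalIntegral.norm_integral_le_of_norm_le_const (a := (ζ : ℝ)) (b := ζ + h)
    (f := fun x => h⁻¹ * (z.fn x - z.fn ζ)) (C := h⁻¹ * (ε / 2 * ‖z‖)) (fun x hx => by
      rw [uIoc_of_le hle] at hx
      rw [norm_mul, Real.norm_of_nonneg (by positivity : 0 ≤ h⁻¹)]
      exact mul_le_mul_of_nonneg_left (z.abs_sub_le h0 hx.1.le (hx.2.trans h1) (by positivity)
        (by linarith [hx.2])) (by positivity))
  refine e4.trans (le_of_eq ?_)
  rw [add_sub_cancel_left, abs_of_pos hpos]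
  field_simp

/-! ### Lower bounds for the first eigenvalues -/

/-- The number `m` bounds from below the first eigenvalues for all the potentials `-δ_ξ`, in the
variational form: the energy dominates every value `z(ξ)²`. -/
def DominatesDeltas (a b m : ℝ) : Prop :=
  ∀ z : W21, ∀ ξ ∈ Icc (0 : ℝ) 1, z.fn ξ ^ 2 ≤ energy a b (fun _ => -m) z

theorem DominatesDeltas.le_of_isEigenvalue {a b m ev : ℝ} (hm : DominatesDeltas a b m) {q : ℝ → ℝ}
    (hq : q ∈ A₁) (h : IsEigenvalue a b (fun x => -q x) ev) : m ≤ ev := by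
  obtain ⟨z, hz, hE⟩ := exists_energy_eq_zero_of_isEigenvalue h
  have h1 := integral_mul_sq_le_of_mem_A₁ hq (hm z)
  have h2 := W21.integral_sq_pos hz
  have i1 := z.intervalIntegrable_energy (p := fun _ => -m) le_rfl zero_le_one le_rfl
    _root_.intervalIntegrable_const
  have e : energy a b (fun x => -q x - ev) z = energy a b (fun _ => -m) z
      - (∫ x in (0 : ℝ)..1, q x * z.fn x ^ 2) + (m - ev) * ∫ x in (0 : ℝ)..1, z.fn x ^ 2 := by
    have e1 : (fun x => -q x - ev) = fun x => (-q x - m) + (m - ev) := by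
      funext x
      ring
    have i2 : IntervalIntegrable (fun x => -q x - m) volume 0 1 :=
      hq.1.neg.sub _root_.intervalIntegrable_const
    rw [e1, energy_add_const i2]
    unfold energy
    rw [← sub_eq_zero]
    have e2 : ∫ x in (0 : ℝ)..1, (z.der x ^ 2 + (-q x - m) * z.fn x ^ 2) =
        (∫ x in (0 : ℝ)..1, (z.der x ^ 2 + -m * z.fn x ^ 2)) -
          ∫ x in (0 : ℝ)..1, q x * z.fn x ^ 2 := by
      rw [← intervalIntegral.integral_sub i1 (z.intervalIntegrable_mul_sq hq.1)]
      congr 1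
      funext x
      ring
    rw [e2]
    ring
  rw [e] at hE
  nlinarith

theorem pencil_neg_self (k₀ k₁ ev : ℝ) (p : Wneg) (z : W21) : pencil k₀ k₁ (-p) ev z z =
    energy (k₀ ^ 2) (k₁ ^ 2) (fun _ => -ev) z - p (z * z) := by
  have e : ∫ x in (0 : ℝ)..1, (z.der x * z.der x - ev * (z.fn x * z.fn x)) =
      ∫ x in (0 : ℝ)..1, (z.der x ^ 2 + -ev * z.fn x ^ 2) := by
    congr 1
    funext x
    ring
  unfold pencil energy
  rw [e, neg_apply]
  ring

theorem DominatesDeltas.le_of_isPencilEigenvalue {k₀ k₁ m ev : ℝ}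
    (hm : DominatesDeltas (k₀ ^ 2) (k₁ ^ 2) m) {r : Wneg} (hr : r ∈ Γ₁)
    (h : IsPencilEigenvalue k₀ k₁ (-r) ev) : m ≤ ev := by
  obtain ⟨z, hz, hE⟩ := h
  have hE := hE z
  have h1 := apply_mul_self_le_of_mem_Γ₁ hr (hm z)
  have h2 := W21.integral_sq_pos hz
  have e1 : (fun _ : ℝ => -ev) = fun _ : ℝ => -m + (m - ev) := by
    funext x
    ring
  rw [pencil_neg_self, e1, energy_add_const _root_.intervalIntegrable_const] at hE
  nlinarith

/-! ### Classical solutions -/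

/-- The function `y` satisfies `-y'' = μ y` on `[c,d]` and has the derivative `v`, one-sided
derivatives being meant at the end points. In the case `c = d` this is no condition. -/
structure IsSolutionOn (μ c d : ℝ) (y v : ℝ → ℝ) : Prop where
  der : ∀ x ∈ Icc c d, HasDerivWithinAt y (v x) (Icc c d) x
  der_der : ∀ x ∈ Icc c d, HasDerivWithinAt v (-(μ * y x)) (Icc c d) x

namespace IsSolutionOn

variable {μ c d : ℝ} {y v : ℝ → ℝ}

theorem continuousOn (h : IsSolutionOn μ c d y v) : ContinuousOn y (Icc c d) :=
  fun x hx => (h.der x hx).continuousWithinAt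

theorem continuousOn_der (h : IsSolutionOn μ c d y v) : ContinuousOn v (Icc c d) :=
  fun x hx => (h.der_der x hx).continuousWithinAt

theorem mono (h : IsSolutionOn μ c d y v) {c' d' : ℝ} (hc : c ≤ c') (hd : d' ≤ d) :
    IsSolutionOn μ c' d' y v :=
  ⟨fun x hx => (h.der x (Icc_subset_Icc hc hd hx)).mono (Icc_subset_Icc hc hd),
    fun x hx => (h.der_der x (Icc_subset_Icc hc hd hx)).mono (Icc_subset_Icc hc hd)⟩

theorem hasDerivAt (h : IsSolutionOn μ c d y v) {x : ℝ} (hx : x ∈ Ioo c d) :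
    HasDerivAt y (v x) x :=
  (h.der x (Ioo_subset_Icc_self hx)).hasDerivAt (Icc_mem_nhds hx.1 hx.2)

theorem integral_eq (h : IsSolutionOn μ c d y v) (hc : 0 ≤ c) (hcd : c ≤ d) (hd : d ≤ 1)
    (z : W21) : ∫ x in c..d, (v x * z.der x - μ * (y x * z.fn x)) =
      v d * z.fn d - v c * z.fn c := by
  have hv : AbsolutelyContinuousOnInterval v c d :=
    absolutelyContinuous_of_hasDerivWithinAt hcd h.der_der
      (continuousOn_const.mul h.continuousOn).neg
  have e := (hv.mul (z.ac hc hcd hd)).integral_deriv_eq_sub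
  simp only [Pi.mul_apply] at e
  rw [← e]
  refine integral_congr_of_ae_Ioo hcd ?_
  filter_upwards [z.ae_hasDerivAt] with x h1 hx
  have h1 := h1 ⟨hc.trans_lt hx.1, hx.2.trans_le hd⟩
  have h2 := (h.der_der x (Ioo_subset_Icc_self hx)).hasDerivAt (Icc_mem_nhds hx.1 hx.2)
  rw [(h2.mul h1).deriv]
  ring

/-- The variation of constants: adding `(k - ∫ y²) θ / y²` to the logarithmic derivative changes
the spectral parameter from `μ` to `μ + θ`, up to an error quadratic in `θ`. -/
theorem hasDerivWithinAt_perturbed (h : IsSolutionOn μ c d y v) (hy : ∀ x ∈ Icc c d, 0 < y x)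
    {Y : ℝ → ℝ} (hY : ∀ x ∈ Icc c d, HasDerivWithinAt Y (y x ^ 2) (Icc c d) x) (k θ : ℝ) :
    ∀ x ∈ Icc c d, HasDerivWithinAt (fun x => v x / y x + θ * ((k - Y x) / y x ^ 2))
      (-(μ + θ) + θ ^ 2 * ((k - Y x) / y x ^ 2) ^ 2 -
        (v x / y x + θ * ((k - Y x) / y x ^ 2)) ^ 2) (Icc c d) x := by
  intro x hx
  have h0 := (hy x hx).ne'
  have h1 := (h.der_der x hx).fun_div (h.der x hx) h0
  have h2 := (((hY x hx).const_sub k).fun_div ((h.der x hx).fun_pow 2) (pow_ne_zero 2 h0)).const_mul θ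
  refine (h1.fun_add h2).congr_deriv ?_
  field_simp
  push_cast
  ring

theorem hasDerivWithinAt_logDeriv (h : IsSolutionOn μ c d y v) (hy : ∀ x ∈ Icc c d, 0 < y x) :
    ∀ x ∈ Icc c d, HasDerivWithinAt (fun x => v x / y x) (-μ - (v x / y x) ^ 2) (Icc c d) x := by
  intro x hx
  have h0 := (hy x hx).ne'
  refine ((h.der_der x hx).fun_div (h.der x hx) h0).congr_deriv ?_
  field_simp

theorem continuousOn_logDeriv (h : IsSolutionOn μ c d y v) (hy : ∀ x ∈ Icc c d, 0 < y x) :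
    ContinuousOn (fun x => v x / y x) (Icc c d) :=
  h.continuousOn_der.div h.continuousOn fun x hx => (hy x hx).ne'

/-- The conservation of the energy `y'² + μ y²`. -/
theorem sq_add_eq (h : IsSolutionOn μ c d y v) {s t : ℝ} (hs : s ∈ Icc c d) (ht : t ∈ Icc c d) :
    v s ^ 2 + μ * y s ^ 2 = v t ^ 2 + μ * y t ^ 2 := by
  have hd : ∀ x ∈ Icc c d, HasDerivWithinAt (fun x => v x ^ 2 + μ * y x ^ 2) 0 (Icc c d) x := by
    intro x hx
    refine (((h.der_der x hx).fun_pow 2).fun_add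
      (((h.der x hx).fun_pow 2).const_mul μ)).congr_deriv ?_
    push_cast
    ring
  have := (convex_Icc c d).norm_image_sub_le_of_norm_hasDerivWithin_le (C := 0) hd
    (fun x _ => by simp) ht hs
  rw [zero_mul] at this
  exact sub_eq_zero.1 (norm_le_zero_iff.1 this)

end IsSolutionOn

/-- A positive first eigenfunction `y` for the potential `-δ_ζ` and the eigenvalue `m`, with the
derivatives `vl` to the left and `vr` to the right of `ζ`. For `ζ = 0` the condition on `vl` is that
`vl 0 = a y(0)`, and hence `vr 0 = (a - 1) y(0)`. -/
structure IsGroundState (a b m ζ : ℝ) (y vl vr : ℝ → ℝ) : Prop where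
  pos : ∀ x ∈ Icc (0 : ℝ) 1, 0 < y x
  left : IsSolutionOn m 0 ζ y vl
  right : IsSolutionOn m ζ 1 y vr
  left_bc : vl 0 = a * y 0
  right_bc : vr 1 = -b * y 1
  jump : vl ζ - vr ζ = y ζ

namespace IsGroundState

variable {a b m ζ : ℝ} {y vl vr : ℝ → ℝ}

theorem exists_lipschitz (h : IsGroundState a b m ζ y vl vr) :
    ∃ K, LipschitzOnWith K y (Icc 0 1) :=
  exists_lipschitzOnWith_union (exists_lipschitzOnWith h.left.der h.left.continuousOn_der)
    (exists_lipschitzOnWith h.right.der h.right.continuousOn_der)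

theorem continuousOn (h : IsGroundState a b m ζ y vl vr) : ContinuousOn y (Icc 0 1) :=
  h.exists_lipschitz.choose_spec.continuousOn

theorem isPencilEigenvalue {k₀ k₁ : ℝ} {ζ : I}
    (h : IsGroundState (k₀ ^ 2) (k₁ ^ 2) m ζ y vl vr) :
    IsPencilEigenvalue k₀ k₁ (-dirac ζ) m := by
  have hζ0 : (0 : ℝ) ≤ ζ := ζ.2.1
  have hζ1 : (ζ : ℝ) ≤ 1 := ζ.2.2
  have hne : ∀ᵐ x : ℝ, x ≠ ζ := by simp [ae_iff, measure_singleton]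
  obtain ⟨w, hw, hw'⟩ := W21.exists_of_lipschitz (V := fun x => if x < ζ then vl x else vr x)
    h.exists_lipschitz (by
      filter_upwards [hne] with x hx hx'
      rcases lt_or_gt_of_ne hx with hx | hx
      · rw [if_pos hx]
        exact h.left.hasDerivAt ⟨hx'.1, hx⟩
      · rw [if_neg hx.not_gt]
        exact h.right.hasDerivAt ⟨hx, hx'.2⟩)
  refine ⟨w, fun h0 => ?_, fun z => ?_⟩
  · have := hw 0 ⟨le_rfl, zero_le_one⟩
    rw [h0] at this
    exact (h.pos 0 ⟨le_rfl, zero_le_one⟩).ne this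
  have hint : IntervalIntegrable (fun x => w.der x * z.der x - m * (w.fn x * z.fn x)) volume 0 1 := by
    rw [intervalIntegrable_iff_integrableOn_Ioc_of_le zero_le_one]
    exact (W21.integrable_der w z).sub ((W21.integrable_fn w z).const_mul m)
  have e1 : ∫ x in (0 : ℝ)..ζ, (w.der x * z.der x - m * (w.fn x * z.fn x)) =
      vl ζ * z.fn ζ - vl 0 * z.fn 0 := by
    rw [← h.left.integral_eq le_rfl hζ0 hζ1 z]
    refine integral_congr_of_ae_Ioo hζ0 ?_
    filter_upwards [hw'] with x a1 hx
    have hx1 : x ∈ Ioo (0 : ℝ) 1 := ⟨hx.1, hx.2.trans_le hζ1⟩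
    rw [a1 hx1, if_pos hx.2, hw x (Ioo_subset_Icc_self hx1)]
  have e2 : ∫ x in (ζ : ℝ)..1, (w.der x * z.der x - m * (w.fn x * z.fn x)) =
      vr 1 * z.fn 1 - vr ζ * z.fn ζ := by
    rw [← h.right.integral_eq hζ0 hζ1 le_rfl z]
    refine integral_congr_of_ae_Ioo hζ1 ?_
    filter_upwards [hw'] with x a1 hx
    have hx1 : x ∈ Ioo (0 : ℝ) 1 := ⟨hζ0.trans_lt hx.1, hx.2⟩
    rw [a1 hx1, if_neg hx.1.not_gt, hw x (Ioo_subset_Icc_self hx1)]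
  have hsub1 : uIcc (0 : ℝ) ζ ⊆ uIcc 0 1 := by
    rw [uIcc_of_le hζ0, uIcc_of_le zero_le_one]
    exact Icc_subset_Icc le_rfl hζ1
  have hsub2 : uIcc (ζ : ℝ) 1 ⊆ uIcc 0 1 := by
    rw [uIcc_of_le hζ1, uIcc_of_le zero_le_one]
    exact Icc_subset_Icc hζ0 le_rfl
  have e3 := intervalIntegral.integral_add_adjacent_intervals (hint.mono_set hsub1)
    (hint.mono_set hsub2)
  unfold pencil
  rw [← e3, e1, e2, neg_apply, dirac_apply, W21.fn_mul, hw 0 ⟨le_rfl, zero_le_one⟩,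
    hw 1 ⟨zero_le_one, le_rfl⟩, hw ζ ⟨hζ0, hζ1⟩]
  linear_combination z.fn ζ * h.jump + z.fn 1 * h.right_bc - z.fn 0 * h.left_bc

/-- Adding a ramp of height `κ` on an interval of a small length `δ` to a function bounded by `B`
changes its square by no more than its slope. -/
theorem add_sq_sub_sq_bounds {w κ χ B δ : ℝ} (hκ0 : 0 ≤ κ) (hκ1 : κ ≤ 1) (hχ0 : 0 ≤ χ)
    (hχ1 : χ ≤ 1) (hB0 : 0 ≤ B) (hB : |w| ≤ B) (hδ0 : 0 < δ) (hδ1 : δ * (2 * B + 1) ≤ 1) :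
    (w + κ * χ) ^ 2 - w ^ 2 ≤ κ / δ ∧ -(2 * B) ≤ (w + κ * χ) ^ 2 - w ^ 2 := by
  have hBx := abs_le.1 hB
  have c3 : 2 * B * κ + κ ≤ κ / δ := by
    rw [le_div_iff₀ hδ0]
    nlinarith
  have c4 : 0 ≤ κ * χ := mul_nonneg hκ0 hχ0
  have c5 : κ * χ ≤ κ := mul_le_of_le_one_right hκ0 hχ1
  have c6 : w * (κ * χ) ≤ B * (κ * χ) := mul_le_mul_of_nonneg_right hBx.2 c4
  have c7 : -B * (κ * χ) ≤ w * (κ * χ) := mul_le_mul_of_nonneg_right hBx.1 c4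
  have c8 : B * (κ * χ) ≤ B * κ := mul_le_mul_of_nonneg_left c5 hB0
  have c9 : B * κ ≤ B := mul_le_of_le_one_right hB0 hκ1
  have c10 : (κ * χ) ^ 2 ≤ κ := by nlinarith
  have c11 : (w + κ * χ) ^ 2 = w ^ 2 + 2 * (w * (κ * χ)) + (κ * χ) ^ 2 := by ring
  have c12 := sq_nonneg (κ * χ)
  constructor <;> linarith

/-- The first eigenvalue `m` for `-δ_ζ` is approximated from above by first eigenvalues for
potentials of class `-A_1`. The logarithmic derivative of the eigenfunction is perturbed so as to
leave room for an increase of the spectral parameter by almost `θ`, which decreases its jump at `ζ`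
from `1` to `κ = 1 - θ j`; the jump is then smoothed out on `[ζ, ζ + h]`. -/
theorem exists_mem_A₁ (h : IsGroundState a b m ζ y vl vr) (hζ0 : 0 ≤ ζ) (hζ1 : ζ < 1) {ε : ℝ}
    (hε : 0 < ε) :
    ∃ q ∈ A₁, ∃ e ≤ m + ε, IsLeast {e | IsEigenvalue a b (fun x => -q x) e} e := by
  have hyc := h.continuousOn
  set yc : ℝ → ℝ := IccExtend (zero_le_one' ℝ) ((Icc (0 : ℝ) 1).domRestrict y) with hycd
  have hcont : Continuous yc := (continuousOn_iff_continuous_domRestrict.1 hyc).Icc_extend'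
  have hye : ∀ x ∈ Icc (0 : ℝ) 1, yc x = y x := fun x hx => by
    simp [hycd, IccExtend, projIcc_of_mem zero_le_one hx]
  set Y : ℝ → ℝ := fun x => ∫ t in (0 : ℝ)..x, yc t ^ 2 with hYd
  have hY : ∀ x ∈ Icc (0 : ℝ) 1, HasDerivAt Y (y x ^ 2) x := fun x hx => by
    rw [← hye x hx]
    exact ((hcont.pow 2).integral_hasStrictDerivAt 0 x).hasDerivAt
  have hYc : ContinuousOn Y (Icc 0 1) := fun x hx => (hY x hx).continuousAt.continuousWithinAt
  have hY0 : Y 0 = 0 := intervalIntegral.integral_same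
  have hS : 0 < Y 1 := by
    refine intervalIntegral.integral_pos zero_lt_one (hcont.pow 2).continuousOn
      (fun _ _ => sq_nonneg _) ⟨0, ⟨le_rfl, zero_le_one⟩, ?_⟩
    rw [hye 0 ⟨le_rfl, zero_le_one⟩]
    exact pow_pos (h.pos 0 ⟨le_rfl, zero_le_one⟩) 2
  have hζ : ζ ∈ Icc (0 : ℝ) 1 := ⟨hζ0, hζ1.le⟩
  have hcD : ∀ k, ContinuousOn (fun x => (k - Y x) / y x ^ 2) (Icc 0 1) := fun k =>
    (continuousOn_const.sub hYc).div (hyc.pow 2) fun x hx => (pow_pos (h.pos x hx) 2).ne'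
  obtain ⟨C, hC0, hCl, hCr⟩ : ∃ C : ℝ, 0 < C ∧
      (∀ x ∈ Icc (0 : ℝ) 1, ((0 - Y x) / y x ^ 2) ^ 2 ≤ C) ∧
      ∀ x ∈ Icc (0 : ℝ) 1, ((Y 1 - Y x) / y x ^ 2) ^ 2 ≤ C := by
    obtain ⟨C1, h1⟩ := isCompact_Icc.exists_bound_of_continuousOn ((hcD 0).pow 2)
    obtain ⟨C2, h2⟩ := isCompact_Icc.exists_bound_of_continuousOn ((hcD (Y 1)).pow 2)
    refine ⟨max C1 C2 + 1, ?_, fun x hx => ?_, fun x hx => ?_⟩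
    · have := (norm_nonneg _).trans (h1 0 ⟨le_rfl, zero_le_one⟩)
      linarith [le_max_left C1 C2]
    · have := (le_abs_self _).trans (h1 x hx)
      simp only [Pi.pow_apply] at this
      linarith [le_max_left C1 C2]
    · have := (le_abs_self _).trans (h2 x hx)
      simp only [Pi.pow_apply] at this
      linarith [le_max_right C1 C2]
  set j : ℝ := Y 1 / y ζ ^ 2 with hj
  have hjp : 0 < j := div_pos hS (pow_pos (h.pos ζ hζ) 2)
  obtain ⟨θ, hθ0, hθε, hθj, hθC⟩ : ∃ θ : ℝ, 0 < θ ∧ θ ≤ ε ∧ θ * j ≤ 1 ∧ C * θ ≤ j / 2 := by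
    refine ⟨min ε (min (1 / j) (j / (2 * C))), by positivity, min_le_left _ _, ?_, ?_⟩
    · have : min ε (min (1 / j) (j / (2 * C))) ≤ 1 / j := (min_le_right _ _).trans (min_le_left _ _)
      rwa [le_div_iff₀ hjp] at this
    · have : min ε (min (1 / j) (j / (2 * C))) ≤ j / (2 * C) :=
        (min_le_right _ _).trans (min_le_right _ _)
      rw [le_div_iff₀ (by positivity)] at this
      linarith
  set κ : ℝ := 1 - θ * j with hκ
  have hκ0 : 0 ≤ κ := by linarith
  have hκ1 : κ ≤ 1 := by nlinarith
  set WL : ℝ → ℝ := fun x => vl x / y x + θ * ((0 - Y x) / y x ^ 2) with hWL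
  set WR : ℝ → ℝ := fun x => vr x / y x + θ * ((Y 1 - Y x) / y x ^ 2) with hWR
  have hL : ∀ x ∈ Icc 0 ζ, HasDerivWithinAt WL
      (-(m + θ) + θ ^ 2 * ((0 - Y x) / y x ^ 2) ^ 2 - WL x ^ 2) (Icc 0 ζ) x :=
    h.left.hasDerivWithinAt_perturbed (fun x hx => h.pos x ⟨hx.1, hx.2.trans hζ1.le⟩)
      (fun x hx => (hY x ⟨hx.1, hx.2.trans hζ1.le⟩).hasDerivWithinAt) 0 θ
  have hR : ∀ x ∈ Icc ζ 1, HasDerivWithinAt WR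
      (-(m + θ) + θ ^ 2 * ((Y 1 - Y x) / y x ^ 2) ^ 2 - WR x ^ 2) (Icc ζ 1) x :=
    h.right.hasDerivWithinAt_perturbed (fun x hx => h.pos x ⟨hζ0.trans hx.1, hx.2⟩)
      (fun x hx => (hY x ⟨hζ0.trans hx.1, hx.2⟩).hasDerivWithinAt) (Y 1) θ
  have hLc : ContinuousOn WL (Icc 0 ζ) := fun x hx => (hL x hx).continuousWithinAt
  have hRc : ContinuousOn WR (Icc ζ 1) := fun x hx => (hR x hx).continuousWithinAt
  obtain ⟨B, hB0, hB⟩ : ∃ B : ℝ, 0 ≤ B ∧ ∀ x ∈ Icc ζ 1, |WR x| ≤ B := by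
    obtain ⟨B, hB⟩ := isCompact_Icc.exists_bound_of_continuousOn hRc
    exact ⟨B, (norm_nonneg _).trans (hB ζ ⟨le_rfl, hζ1.le⟩), hB⟩
  obtain ⟨δ, hδ0, hδζ, hδ1, hδ2⟩ : ∃ δ : ℝ, 0 < δ ∧ ζ + δ ≤ 1 ∧ δ * (2 * B + 1) ≤ 1 ∧
      2 * B * δ ≤ θ * j / 2 := by
    have hm : 0 < min 1 (θ * j) := lt_min one_pos (by positivity)
    have hm' : 0 < 1 - ζ := by linarith
    set δ := min (1 - ζ) (min 1 (θ * j) / (4 * B + 1)) with hδ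
    have a1 : 0 < δ := lt_min hm' (by positivity)
    have a2 : δ ≤ min 1 (θ * j) / (4 * B + 1) := min_le_right _ _
    rw [le_div_iff₀ (by positivity)] at a2
    have a3 := min_le_left 1 (θ * j)
    have a4 := min_le_right 1 (θ * j)
    have a5 : δ ≤ 1 - ζ := min_le_left _ _
    have a6 : 0 ≤ δ * B := by positivity
    exact ⟨δ, a1, by linarith, by nlinarith, by nlinarith⟩
  have hjump : WL ζ = WR ζ + κ := by
    have hz := (h.pos ζ hζ).ne'
    have hjm := h.jump
    simp only [hWL, hWR, hκ, hj]
    field_simp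
    linear_combination y ζ * hjm
  set W : ℝ → ℝ := fun x => if x ≤ ζ then WL x else WR x + κ * max 0 (1 - (x - ζ) / δ) with hW
  have w1 : ∀ x ∈ Icc 0 ζ, W x = WL x := fun x hx => if_pos hx.2
  have w2 : ∀ x ∈ Icc ζ (ζ + δ), W x = WR x + κ * (1 - (x - ζ) / δ) := by
    intro x hx
    rcases eq_or_lt_of_le hx.1 with rfl | hx'
    · rw [w1 ζ ⟨hζ0, le_rfl⟩, hjump]
      simp
    · have : (x - ζ) / δ ≤ 1 := by
        rw [div_le_one hδ0]
        linarith [hx.2]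
      simp only [hW, if_neg hx'.not_ge]
      rw [max_eq_right (by linarith)]
  have w3 : ∀ x ∈ Icc (ζ + δ) 1, W x = WR x := by
    intro x hx
    have hx' : ζ < x := by linarith [hx.1]
    have : 1 ≤ (x - ζ) / δ := by
      rw [one_le_div hδ0]
      linarith [hx.1]
    simp only [hW, if_neg hx'.not_ge]
    rw [max_eq_left (by linarith)]
    ring
  have d1 : ∀ x ∈ Icc 0 ζ, HasDerivWithinAt W
      (-(m + θ) + θ ^ 2 * ((0 - Y x) / y x ^ 2) ^ 2 - WL x ^ 2) (Icc 0 ζ) x :=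
    fun x hx => (hL x hx).congr w1 (w1 x hx)
  have d2 : ∀ x ∈ Icc ζ (ζ + δ), HasDerivWithinAt W
      (-(m + θ) + θ ^ 2 * ((Y 1 - Y x) / y x ^ 2) ^ 2 - WR x ^ 2 - κ / δ) (Icc ζ (ζ + δ)) x := by
    intro x hx
    have c1 := (hR x ⟨hx.1, hx.2.trans hδζ⟩).mono (Icc_subset_Icc le_rfl hδζ)
    have c2 : HasDerivWithinAt (fun x => κ * (1 - (x - ζ) / δ)) (-(κ / δ)) (Icc ζ (ζ + δ)) x := by
      refine (((((hasDerivAt_id x).sub_const ζ).div_const δ).const_sub 1).const_mul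
        κ).hasDerivWithinAt.congr_deriv ?_
      ring
    exact (c1.fun_add c2).congr w2 (w2 x hx)
  have d3 : ∀ x ∈ Icc (ζ + δ) 1, HasDerivWithinAt W
      (-(m + θ) + θ ^ 2 * ((Y 1 - Y x) / y x ^ 2) ^ 2 - WR x ^ 2) (Icc (ζ + δ) 1) x :=
    fun x hx => ((hR x ⟨by linarith [hx.1], hx.2⟩).mono
      (Icc_subset_Icc (by linarith) le_rfl)).congr w3 (w3 x hx)
  have hRd : ContinuousOn (fun x => -(m + θ) + θ ^ 2 * ((Y 1 - Y x) / y x ^ 2) ^ 2 - WR x ^ 2)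
      (Icc ζ 1) :=
    (continuousOn_const.add (continuousOn_const.mul
      (((hcD (Y 1)).mono (Icc_subset_Icc hζ0 le_rfl)).pow 2))).sub (hRc.pow 2)
  have hLd : ContinuousOn (fun x => -(m + θ) + θ ^ 2 * ((0 - Y x) / y x ^ 2) ^ 2 - WL x ^ 2)
      (Icc 0 ζ) :=
    (continuousOn_const.add (continuousOn_const.mul
      (((hcD 0).mono (Icc_subset_Icc le_rfl hζ1.le)).pow 2))).sub (hLc.pow 2)
  have hWlip : ∃ K, LipschitzOnWith K W (Icc 0 1) :=
    exists_lipschitzOnWith_union (exists_lipschitzOnWith d1 hLd)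
      (exists_lipschitzOnWith_union
        (exists_lipschitzOnWith d2 ((hRd.mono (Icc_subset_Icc le_rfl hδζ)).sub continuousOn_const))
        (exists_lipschitzOnWith d3 (hRd.mono (Icc_subset_Icc (by linarith) le_rfl))))
  have hWac : AbsolutelyContinuousOnInterval W 0 1 := by
    obtain ⟨K, hK⟩ := hWlip
    refine LipschitzOnWith.absolutelyContinuousOnInterval (K := K) ?_
    rwa [uIcc_of_le zero_le_one]
  have hW0 : W 0 = a := by
    have := (h.pos 0 ⟨le_rfl, zero_le_one⟩).ne'
    rw [w1 0 ⟨le_rfl, hζ0⟩]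
    simp only [hWL, hY0, h.left_bc]
    field_simp
    ring
  have hW1 : W 1 = -b := by
    have := (h.pos 1 ⟨zero_le_one, le_rfl⟩).ne'
    rw [w3 1 ⟨hδζ, le_rfl⟩]
    simp only [hWR, h.right_bc]
    field_simp
    ring
  -- on `[ζ, ζ + δ]` the slope `-κ / δ` of the ramp makes up for the terms containing its height
  have key : ∀ᵐ x : ℝ, x ∈ Ioo (0 : ℝ) 1 → deriv W x + W x ^ 2 ≤ -(m + θ - θ ^ 2 * C) ∧
      -(m + θ) - (Ioc ζ (ζ + δ)).indicator (fun _ => κ / δ + 2 * B) x ≤ deriv W x + W x ^ 2 := by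
    have hne : ∀ x₀ : ℝ, ∀ᵐ x : ℝ, x ≠ x₀ := fun x₀ => by simp [ae_iff, measure_singleton]
    filter_upwards [hne ζ, hne (ζ + δ)] with x n1 n2 hx
    have hx' := Ioo_subset_Icc_self hx
    have t1 := mul_le_mul_of_nonneg_left (hCl x hx') (sq_nonneg θ)
    have t2 := mul_le_mul_of_nonneg_left (hCr x hx') (sq_nonneg θ)
    have t3 : 0 ≤ θ ^ 2 * ((0 - Y x) / y x ^ 2) ^ 2 := by positivity
    have t4 : 0 ≤ θ ^ 2 * ((Y 1 - Y x) / y x ^ 2) ^ 2 := by positivity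
    rcases lt_or_gt_of_ne n1 with l1 | l1
    · have m1 : x ∈ Icc 0 ζ := ⟨hx.1.le, l1.le⟩
      rw [((d1 x m1).hasDerivAt (Icc_mem_nhds hx.1 l1)).deriv, w1 x m1,
        indicator_of_notMem (fun hm => l1.not_gt hm.1)]
      constructor <;> linarith
    · rcases lt_or_gt_of_ne n2 with l2 | l2
      · have m1 : x ∈ Icc ζ (ζ + δ) := ⟨l1.le, l2.le⟩
        rw [((d2 x m1).hasDerivAt (Icc_mem_nhds l1 l2)).deriv, w2 x m1,
          indicator_of_mem (show x ∈ Ioc ζ (ζ + δ) from ⟨l1, l2.le⟩)]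
        set χ := 1 - (x - ζ) / δ with hχ
        have c1 : 0 ≤ χ := by
          have : (x - ζ) / δ ≤ 1 := by
            rw [div_le_one hδ0]
            linarith
          linarith
        have c2 : χ ≤ 1 := by
          have : 0 ≤ (x - ζ) / δ := div_nonneg (by linarith) hδ0.le
          linarith
        obtain ⟨c3, c4⟩ := add_sq_sub_sq_bounds hκ0 hκ1 c1 c2 hB0 (hB x ⟨l1.le, hx.2.le⟩) hδ0 hδ1
        constructor <;> linarith
      · have m1 : x ∈ Icc (ζ + δ) 1 := ⟨l2.le, hx.2.le⟩
        rw [((d3 x m1).hasDerivAt (Icc_mem_nhds l2 hx.2)).deriv, w3 x m1,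
          indicator_of_notMem (fun hm => l2.not_ge hm.2)]
        constructor <;> linarith
  have i1 : IntervalIntegrable (deriv W) volume 0 1 := hWac.intervalIntegrable_deriv
  have i2 : IntervalIntegrable (fun x => W x ^ 2) volume 0 1 :=
    (hWac.continuousOn.pow 2).intervalIntegrable
  have i3 : IntervalIntegrable ((Ioc ζ (ζ + δ)).indicator fun _ => κ / δ + 2 * B) volume 0 1 := by
    rw [intervalIntegrable_iff_integrableOn_Ioc_of_le zero_le_one]
    exact (integrableOn_const (by simp)).indicator measurableSet_Ioc
  have hmass := integral_mono_of_ae_Ioo zero_le_one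
    (_root_.intervalIntegrable_const.sub i3) (i1.add i2)
    (by filter_upwards [key] with x hx hx' using (hx hx').2)
  rw [intervalIntegral.integral_sub _root_.intervalIntegrable_const i3,
    intervalIntegral.integral_add i1 i2, integral_indicator_Ioc hζ0 (by linarith) hδζ,
    hWac.integral_deriv_eq_sub, hW0, hW1] at hmass
  simp only [intervalIntegral.integral_const, sub_zero, add_sub_cancel_left,
    smul_eq_mul] at hmass
  have e1 : δ * (κ / δ + 2 * B) = κ + 2 * B * δ := by field_simp
  rw [e1] at hmass
  have e2 : θ ^ 2 * C ≤ θ * j / 2 := by nlinarith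
  obtain ⟨q, hq, e, he, hl⟩ := exists_mem_A₁_of_riccati hWac
    (by filter_upwards [key] with x hx hx' using (hx hx').1) hW0 hW1 (by linarith)
  have : 0 ≤ θ ^ 2 * C := by positivity
  exact ⟨q, hq, e, by linarith, hl⟩

/-- A positive eigenfunction for `-δ_ζ` whose eigenvalue bounds from below the first eigenvalues
for all the potentials `-δ_ξ` solves the extremal problem. -/
theorem m₁negEqAttainedAt {k₀ k₁ : ℝ} {ζ : I} (hζ : (ζ : ℝ) < 1)
    (h : IsGroundState (k₀ ^ 2) (k₁ ^ 2) m ζ y vl vr)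
    (hm : DominatesDeltas (k₀ ^ 2) (k₁ ^ 2) m) : M₁negEqAttainedAt k₀ k₁ m (dirac ζ) := by
  have hΓ := dirac_mem_Γ₁ hζ
  refine ⟨⟨?_, fun c hc => le_of_forall_pos_le_add fun ε hε => ?_⟩, hΓ,
    ⟨h.isPencilEigenvalue, fun ev hev => hm.le_of_isPencilEigenvalue hΓ hev⟩,
    fun r hr ev hev => hm.le_of_isPencilEigenvalue hr hev.1⟩
  · rintro ev ⟨q, hq, hev⟩
    exact hm.le_of_isEigenvalue hq hev.1
  · obtain ⟨q, hq, e, he, hl⟩ := h.exists_mem_A₁ ζ.2.1 hζ hε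
    exact (hc ⟨q, hq, hl⟩).trans he

end IsGroundState

/-! ### Comparison of the deltas at different points -/

namespace IsSolutionOn

variable {μ c d : ℝ} {y v : ℝ → ℝ}

/-- The solution `x ↦ y (s - x)` of the reflected problem. -/
theorem reflect (h : IsSolutionOn μ c d y v) (s : ℝ) :
    IsSolutionOn μ (s - d) (s - c) (fun x => y (s - x)) (fun x => -v (s - x)) := by
  have hm : MapsTo (fun x => s - x) (Icc (s - d) (s - c)) (Icc c d) := fun x hx =>
    ⟨by linarith [hx.2], by linarith [hx.1]⟩
  have hs : ∀ x, HasDerivWithinAt (fun x => s - x) (-1) (Icc (s - d) (s - c)) x := fun x =>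
    ((hasDerivAt_id x).const_sub s).hasDerivWithinAt
  refine ⟨fun x hx => ?_, fun x hx => ?_⟩
  · refine ((h.der _ (hm hx)).comp x (hs x) hm).congr_deriv ?_
    ring
  · refine ((h.der_der _ (hm hx)).comp x (hs x) hm).fun_neg.congr_deriv ?_
    ring

theorem deriv_logDeriv (h : IsSolutionOn μ c d y v) (hy : ∀ x ∈ Icc c d, 0 < y x) {x t : ℝ}
    (hx : x ∈ Ioo c d) (ht : t ∈ Icc c d) :
    deriv (fun x => v x / y x) x = -(v t ^ 2 + μ * y t ^ 2) / y x ^ 2 := by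
  have hx' := Ioo_subset_Icc_self hx
  have := (hy x hx').ne'
  rw [((h.hasDerivWithinAt_logDeriv hy x hx').hasDerivAt (Icc_mem_nhds hx.1 hx.2)).deriv,
    h.sq_add_eq ht hx']
  field_simp
  ring

theorem differentiableOn_logDeriv (h : IsSolutionOn μ c d y v) (hy : ∀ x ∈ Icc c d, 0 < y x) :
    DifferentiableOn ℝ (fun x => v x / y x) (interior (Icc c d)) := fun x hx =>
  (h.hasDerivWithinAt_logDeriv hy x (interior_subset hx)).differentiableWithinAt.mono
    interior_subset

theorem antitoneOn_logDeriv (h : IsSolutionOn μ c d y v) (hy : ∀ x ∈ Icc c d, 0 < y x) {t : ℝ}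
    (ht : t ∈ Icc c d) (hE : 0 ≤ v t ^ 2 + μ * y t ^ 2) :
    AntitoneOn (fun x => v x / y x) (Icc c d) := by
  refine antitoneOn_of_deriv_nonpos (convex_Icc c d) (h.continuousOn_logDeriv hy)
    (h.differentiableOn_logDeriv hy) fun x hx => ?_
  rw [interior_Icc] at hx
  rw [h.deriv_logDeriv hy hx ht]
  exact div_nonpos_of_nonpos_of_nonneg (by linarith) (sq_nonneg _)

theorem monotoneOn_logDeriv (h : IsSolutionOn μ c d y v) (hy : ∀ x ∈ Icc c d, 0 < y x) {t : ℝ}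
    (ht : t ∈ Icc c d) (hE : v t ^ 2 + μ * y t ^ 2 ≤ 0) :
    MonotoneOn (fun x => v x / y x) (Icc c d) := by
  refine monotoneOn_of_deriv_nonneg (convex_Icc c d) (h.continuousOn_logDeriv hy)
    (h.differentiableOn_logDeriv hy) fun x hx => ?_
  rw [interior_Icc] at hx
  rw [h.deriv_logDeriv hy hx ht]
  exact div_nonneg (by linarith) (sq_nonneg _)

/-- Picone's inequality for the logarithmic derivative of `y`, shifted by a constant `k` such that
the Riccati inequality is preserved. -/
theorem picone_add_const (h : IsSolutionOn μ c d y v) (hy : ∀ x ∈ Icc c d, 0 < y x) (hc : 0 ≤ c)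
    (hcd : c ≤ d) (hd : d ≤ 1) (k : ℝ) (hk : ∀ x ∈ Ioo c d, k * (2 * (v x / y x) + k) ≤ 0)
    (z : W21) : (v d / y d + k) * z.fn d ^ 2 - (v c / y c + k) * z.fn c ^ 2 ≤
      ∫ x in c..d, (z.der x ^ 2 + -μ * z.fn x ^ 2) := by
  refine picone_of_hasDerivWithinAt z hc hcd hd (W := fun x => v x / y x + k)
    (fun x hx => (h.hasDerivWithinAt_logDeriv hy x hx).add_const k)
    (continuousOn_const.sub ((h.continuousOn_logDeriv hy).pow 2)) fun x hx => ?_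
  have := hk x hx
  nlinarith

theorem picone (h : IsSolutionOn μ c d y v) (hy : ∀ x ∈ Icc c d, 0 < y x) (hc : 0 ≤ c)
    (hcd : c ≤ d) (hd : d ≤ 1) (z : W21) :
    v d / y d * z.fn d ^ 2 - v c / y c * z.fn c ^ 2 ≤
      ∫ x in c..d, (z.der x ^ 2 + -μ * z.fn x ^ 2) := by
  simpa using h.picone_add_const hy hc hcd hd 0 (by simp) z

end IsSolutionOn

theorem W21.integral_add_adjacent (z : W21) (m : ℝ) {c e d : ℝ} (hc : 0 ≤ c) (hce : c ≤ e)
    (hed : e ≤ d) (hd : d ≤ 1) :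
    (∫ x in c..e, (z.der x ^ 2 + -m * z.fn x ^ 2)) +
      ∫ x in e..d, (z.der x ^ 2 + -m * z.fn x ^ 2) =
      ∫ x in c..d, (z.der x ^ 2 + -m * z.fn x ^ 2) :=
  intervalIntegral.integral_add_adjacent_intervals
    (z.intervalIntegrable_energy hc hce (hed.trans hd) _root_.intervalIntegrable_const)
    (z.intervalIntegrable_energy (hc.trans hce) hed hd _root_.intervalIntegrable_const)

/-- If the logarithmic derivative `w` of the ground state is at least `1/2` on the left of `ζ` and
at most `-1/2` on the right of it, then its jump can be moved from `ζ` to any other point `ξ`: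
between `ζ` and `ξ` the Riccati inequality is inherited by `w - 1` or `w + 1`. -/
theorem IsGroundState.dominatesDeltas {a b m ζ : ℝ} {y vl vr : ℝ → ℝ}
    (h : IsGroundState a b m ζ y vl vr) (hζ : ζ ∈ Icc (0 : ℝ) 1)
    (hl : ∀ x ∈ Ico 0 ζ, 1 / 2 ≤ vl x / y x) (hr : ∀ x ∈ Icc ζ 1, vr x / y x ≤ -(1 / 2)) :
    DominatesDeltas a b m := by
  intro z ξ hξ
  have h0 := (h.pos 0 ⟨le_rfl, zero_le_one⟩).ne'
  have h1 := (h.pos 1 ⟨zero_le_one, le_rfl⟩).ne'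
  have hz := (h.pos ζ hζ).ne'
  have e0 : vl 0 / y 0 = a := by rw [h.left_bc, mul_div_cancel_right₀ _ h0]
  have e1 : vr 1 / y 1 = -b := by rw [h.right_bc, mul_div_cancel_right₀ _ h1]
  have ej : vl ζ / y ζ = vr ζ / y ζ + 1 := by
    have := h.jump
    field_simp
    linarith
  have hpos : ∀ {c d : ℝ}, 0 ≤ c → d ≤ 1 → ∀ x ∈ Icc c d, 0 < y x := fun hc hd x hx =>
    h.pos x ⟨hc.trans hx.1, hx.2.trans hd⟩
  unfold energy
  rcases le_total ξ ζ with hle | hle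
  · have p1 := (h.left.mono le_rfl hle).picone (hpos le_rfl hξ.2) le_rfl hξ.1 hξ.2 z
    have p2 := (h.left.mono hξ.1 le_rfl).picone_add_const (hpos hξ.1 hζ.2) hξ.1 hle hζ.2 (-1)
      (fun x hx => by linarith [hl x ⟨hξ.1.trans hx.1.le, hx.2⟩]) z
    have p3 := h.right.picone (hpos hζ.1 le_rfl) hζ.1 hζ.2 le_rfl z
    have s1 := z.integral_add_adjacent m le_rfl hξ.1 hle hζ.2
    have s2 := z.integral_add_adjacent m le_rfl hζ.1 hζ.2 le_rfl
    rw [e0] at p1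
    rw [e1] at p3
    rw [ej] at p2
    linarith
  · have p1 := h.left.picone (hpos le_rfl hζ.2) le_rfl hζ.1 hζ.2 z
    have p2 := (h.right.mono le_rfl hξ.2).picone_add_const (hpos hζ.1 hξ.2) hζ.1 hle hξ.2 1
      (fun x hx => by linarith [hr x ⟨hx.1.le, hx.2.le.trans hξ.2⟩]) z
    have p3 := (h.right.mono hle le_rfl).picone (hpos hξ.1 le_rfl) hξ.1 hξ.2 le_rfl z
    have s1 := z.integral_add_adjacent m le_rfl hζ.1 hle hξ.2
    have s2 := z.integral_add_adjacent m le_rfl hξ.1 hξ.2 le_rfl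
    rw [e0, ej] at p1
    rw [e1] at p3
    linarith

/-- With `R = -y'/y` decreasing and non-negative, hence concave since `R' = m + R²`, the function
`R(1 - x) - (b - a)` takes the place of `w + 1` in `IsGroundState.dominatesDeltas`. -/
theorem dominatesDeltas_of_monotoneOn {a b m : ℝ} (ha : 0 ≤ a) (hab : a ≤ b) {y v : ℝ → ℝ}
    (h : IsSolutionOn m 0 1 y v) (hy : ∀ x ∈ Icc (0 : ℝ) 1, 0 < y x) (h0 : v 0 / y 0 = a - 1)
    (h1 : v 1 / y 1 = -b) (hmono : MonotoneOn (fun x => v x / y x) (Icc 0 1)) :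
    DominatesDeltas a b m := by
  intro z ξ hξ
  have hneg : ∀ x ∈ Icc (0 : ℝ) 1, v x / y x ≤ -b := fun x hx => by
    rw [← h1]
    exact hmono hx ⟨zero_le_one, le_rfl⟩ hx.2
  have hrefl := h.reflect 1
  simp only [sub_self, sub_zero] at hrefl
  have hmem : ∀ x ∈ Icc (0 : ℝ) 1, 1 - x ∈ Icc (0 : ℝ) 1 := fun x hx =>
    ⟨by linarith [hx.2], by linarith [hx.1]⟩
  have hyr : ∀ x ∈ Icc (0 : ℝ) 1, 0 < y (1 - x) := fun x hx => hy _ (hmem x hx)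
  have hf : ∀ x ∈ Icc (0 : ℝ) (1 / 2), v x / y x + v (1 - x) / y (1 - x) ≤ a - 1 - b := by
    have hd : ∀ x ∈ Icc (0 : ℝ) 1, HasDerivWithinAt
        (fun x => v x / y x - -v (1 - x) / y (1 - x)) ((-m - (v x / y x) ^ 2) -
          (-m - (-v (1 - x) / y (1 - x)) ^ 2)) (Icc 0 1) x := fun x hx =>
      (h.hasDerivWithinAt_logDeriv hy x hx).fun_sub (hrefl.hasDerivWithinAt_logDeriv hyr x hx)
    have hsub : Icc (0 : ℝ) (1 / 2) ⊆ Icc 0 1 := Icc_subset_Icc le_rfl (by norm_num)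
    have hanti : AntitoneOn (fun x => v x / y x - -v (1 - x) / y (1 - x)) (Icc 0 (1 / 2)) := by
      refine antitoneOn_of_deriv_nonpos (convex_Icc _ _)
        (fun x hx => ((hd x (hsub hx)).mono hsub).continuousWithinAt)
        (fun x hx => ((hd x (hsub (interior_subset hx))).mono
          (interior_subset.trans hsub)).differentiableWithinAt) fun x hx => ?_
      rw [interior_Icc] at hx
      have hx' : x ∈ Icc (0 : ℝ) 1 := ⟨hx.1.le, by linarith [hx.2]⟩
      rw [((hd x hx').hasDerivAt (Icc_mem_nhds hx.1 (by linarith [hx.2]))).deriv]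
      have i1 : v x / y x ≤ v (1 - x) / y (1 - x) := hmono hx' (hmem x hx') (by linarith [hx.2])
      have i2 := hneg _ (hmem x hx')
      rw [neg_div, neg_sq]
      nlinarith
    intro x hx
    have := hanti ⟨le_rfl, by norm_num⟩ hx hx.1
    simp only [sub_zero, neg_div, h0, h1] at this
    linarith
  have hfξ : v ξ / y ξ + v (1 - ξ) / y (1 - ξ) ≤ a - 1 - b := by
    rcases le_total ξ (1 / 2) with hle | hle
    · exact hf ξ ⟨hξ.1, hle⟩
    · have := hf (1 - ξ) ⟨by linarith [hξ.2], by linarith⟩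
      rw [sub_sub_cancel] at this
      linarith
  have p1 := (hrefl.mono le_rfl hξ.2).picone_add_const
    (fun x hx => hyr x ⟨hx.1, hx.2.trans hξ.2⟩) le_rfl hξ.1 hξ.2 (a - b) (fun x hx => by
      have := hneg _ (hmem x ⟨hx.1.le, hx.2.le.trans hξ.2⟩)
      rw [neg_div]
      nlinarith) z
  have p2 := (h.mono hξ.1 le_rfl).picone (fun x hx => hy x ⟨hξ.1.trans hx.1, hx.2⟩)
    hξ.1 hξ.2 le_rfl z
  have s1 := z.integral_add_adjacent m le_rfl hξ.1 hξ.2 le_rfl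
  simp only [sub_zero, neg_div, h1] at p1 p2
  have := mul_le_mul_of_nonneg_right hfξ (sq_nonneg (z.fn ξ))
  unfold energy
  linarith

/-! ### Potentials supported at an inner point -/

theorem hasDerivWithinAt_Icc_of_continuousOn {f g : ℝ → ℝ} {c d : ℝ} (hcd : c < d)
    (hf : ContinuousOn f (Icc c d)) (hg : ContinuousOn g (Icc c d))
    (hd : ∀ x ∈ Ioo c d, HasDerivAt f (g x) x) :
    ∀ x ∈ Icc c d, HasDerivWithinAt f (g x) (Icc c d) x := by
  have hdiff : DifferentiableOn ℝ f (Ioo c d) := fun x hx =>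
    (hd x hx).differentiableAt.differentiableWithinAt
  intro x hx
  rcases eq_or_lt_of_le hx.1 with rfl | h1
  · refine (hasDerivWithinAt_Ici_of_tendsto_deriv hdiff
      ((hf c hx).mono Ioo_subset_Icc_self) (Ioo_mem_nhdsGT hcd) ?_).mono Icc_subset_Ici_self
    have : Tendsto g (𝓝[Ioo c d] c) (𝓝 (g c)) := (hg c hx).mono Ioo_subset_Icc_self
    rw [nhdsWithin_Ioo_eq_nhdsGT hcd] at this
    refine this.congr' ?_
    filter_upwards [Ioo_mem_nhdsGT hcd] with t ht using (hd t ht).deriv.symm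
  rcases eq_or_lt_of_le hx.2 with rfl | h2
  · refine (hasDerivWithinAt_Iic_of_tendsto_deriv hdiff
      ((hf x hx).mono Ioo_subset_Icc_self) (Ioo_mem_nhdsLT hcd) ?_).mono Icc_subset_Iic_self
    have : Tendsto g (𝓝[Ioo c x] x) (𝓝 (g x)) := (hg x hx).mono Ioo_subset_Icc_self
    rw [nhdsWithin_Ioo_eq_nhdsLT hcd] at this
    refine this.congr' ?_
    filter_upwards [Ioo_mem_nhdsLT hcd] with t ht using (hd t ht).deriv.symm
  · exact (hd x ⟨h1, h2⟩).hasDerivWithinAt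

/-- A solution on an open interval whose derivative has limits at the end points is a solution up
to the end points. -/
theorem exists_isSolutionOn_of_tendsto {μ c d dc dd : ℝ} {y : ℝ → ℝ} (hcd : c < d)
    (hy : ContinuousOn y (Icc c d))
    (hs : ∀ x ∈ Ioo c d, DifferentiableAt ℝ y x ∧ HasDerivAt (deriv y) (-(μ * y x)) x)
    (hc : Tendsto (deriv y) (𝓝[>] c) (𝓝 dc)) (hd : Tendsto (deriv y) (𝓝[<] d) (𝓝 dd)) :
    ∃ v, IsSolutionOn μ c d y v ∧ v c = dc ∧ v d = dd := by
  have hdc : ContinuousOn (deriv y) (Ioo c d) := fun x hx =>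
    (hs x hx).2.continuousAt.continuousWithinAt
  set v := extendFrom (Ioo c d) (deriv y) with hv
  have hvc : ContinuousOn v (Icc c d) := continuousOn_Icc_extendFrom_Ioo hdc hc hd
  have hve : ∀ x ∈ Ioo c d, v x = deriv y x := fun x hx =>
    extendFrom_eq (subset_closure hx) ((hdc x hx).tendsto)
  refine ⟨v, ⟨?_, ?_⟩, eq_lim_at_left_extendFrom_Ioo hcd hc,
    eq_lim_at_right_extendFrom_Ioo hcd hd⟩
  · refine hasDerivWithinAt_Icc_of_continuousOn hcd hy hvc fun x hx => ?_
    rw [hve x hx]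
    exact (hs x hx).1.hasDerivAt
  · refine hasDerivWithinAt_Icc_of_continuousOn hcd hvc (continuousOn_const.mul hy).neg
      fun x hx => (hs x hx).2.congr_of_eventuallyEq ?_
    filter_upwards [Ioo_mem_nhds hx.1 hx.2] with t ht using hve t ht

theorem m₁negEqAttainedAt_of_hasPositiveSolution {k₀ k₁ μ : ℝ} (hk₀ : 0 ≤ k₀) (hk : k₀ ≤ k₁)
    {ζ : I} (hζ : (ζ : ℝ) ∈ Ioo (0 : ℝ) 1) (hμ : -(k₀ ^ 4) ≤ μ)
    (h : HasPositiveSolution k₀ k₁ μ ζ) : M₁negEqAttainedAt k₀ k₁ μ (dirac ζ) := by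
  obtain ⟨y, hyc, hpos, hs, d₀, dl, dr, d₁, t0, tl, tr, t1, b0, bl, br, b1⟩ := h
  obtain ⟨vl, sl, vl0, vlζ⟩ := exists_isSolutionOn_of_tendsto hζ.1
    (hyc.mono (Icc_subset_Icc le_rfl hζ.2.le)) (fun x hx => hs x (Or.inl hx)) t0 tl
  obtain ⟨vr, sr, vrζ, vr1⟩ := exists_isSolutionOn_of_tendsto hζ.2
    (hyc.mono (Icc_subset_Icc hζ.1.le le_rfl)) (fun x hx => hs x (Or.inr hx)) tr t1
  have hgs : IsGroundState (k₀ ^ 2) (k₁ ^ 2) μ ζ y vl vr :=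
    ⟨hpos, sl, sr, by rw [vl0]; linarith, by rw [vr1]; linarith, by rw [vlζ, vrζ]; linarith⟩
  have hyζ := hpos ζ ⟨hζ.1.le, hζ.2.le⟩
  have posl : ∀ x ∈ Icc (0 : ℝ) ζ, 0 < y x := fun x hx => hpos x ⟨hx.1, hx.2.trans hζ.2.le⟩
  have posr : ∀ x ∈ Icc (ζ : ℝ) 1, 0 < y x := fun x hx => hpos x ⟨hζ.1.le.trans hx.1, hx.2⟩
  have hk4 : k₀ ^ 4 ≤ k₁ ^ 4 := pow_le_pow_left₀ hk₀ hk 4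
  have antil := sl.antitoneOn_logDeriv posl ⟨le_rfl, hζ.1.le⟩ (by
    rw [hgs.left_bc]
    nlinarith [sq_nonneg (y 0)])
  have antir := sr.antitoneOn_logDeriv posr ⟨hζ.2.le, le_rfl⟩ (by
    rw [hgs.right_bc]
    nlinarith [sq_nonneg (y 1)])
  refine hgs.m₁negEqAttainedAt hζ.2 (hgs.dominatesDeltas ζ.2 (fun x hx => ?_) fun x hx => ?_)
  · refine le_trans ?_ (antil ⟨hx.1, hx.2.le⟩ ⟨hζ.1.le, le_rfl⟩ hx.2.le)
    simp only [vlζ]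
    rw [le_div_iff₀ hyζ]
    linarith
  · refine le_trans (antir ⟨le_rfl, hζ.2.le⟩ hx hx.1) ?_
    simp only [vrζ]
    rw [div_le_iff₀ hyζ]
    linarith

/-! ### Solutions with prescribed logarithmic derivatives -/

theorem exists_solution (μ A B : ℝ) : ∃ g dg : ℝ → ℝ, (∀ x, HasDerivAt g (dg x) x) ∧
    (∀ x, HasDerivAt dg (-(μ * g x)) x) ∧ g 0 = A ∧ dg 0 = B := by
  rcases lt_trichotomy μ 0 with hμ | rfl | hμ
  · have hs : 0 < √(-μ) := Real.sqrt_pos.2 (by linarith)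
    have hsq : √(-μ) ^ 2 = -μ := Real.sq_sqrt (by linarith)
    set k := √(-μ) with hk
    have hid : ∀ x, HasDerivAt (fun x => k * x) k x := fun x => by
      simpa using (hasDerivAt_id x).const_mul k
    refine ⟨fun x => A * Real.cosh (k * x) + B / k * Real.sinh (k * x),
      fun x => A * k * Real.sinh (k * x) + B * Real.cosh (k * x), fun x => ?_, fun x => ?_,
      by simp, by simp⟩
    · refine (((hid x).cosh.const_mul A).fun_add ((hid x).sinh.const_mul (B / k))).congr_deriv ?_
      field_simp
    · refine (((hid x).sinh.const_mul (A * k)).fun_add ((hid x).cosh.const_mul B)).congr_deriv ?_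
      have : μ = -k ^ 2 := by linarith
      rw [this]
      field_simp
  · refine ⟨fun x => A + B * x, fun _ => B, fun x => ?_, fun x => ?_, by simp, rfl⟩
    · simpa using ((hasDerivAt_id x).const_mul B).const_add A
    · simpa using hasDerivAt_const x B
  · have hs : 0 < √μ := Real.sqrt_pos.2 hμ
    have hsq : √μ ^ 2 = μ := Real.sq_sqrt hμ.le
    set k := √μ with hk
    have hid : ∀ x, HasDerivAt (fun x => k * x) k x := fun x => by
      simpa using (hasDerivAt_id x).const_mul k
    refine ⟨fun x => A * Real.cos (k * x) + B / k * Real.sin (k * x),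
      fun x => -(A * k) * Real.sin (k * x) + B * Real.cos (k * x), fun x => ?_, fun x => ?_,
      by simp, by simp⟩
    · refine (((hid x).cos.const_mul A).fun_add ((hid x).sin.const_mul (B / k))).congr_deriv ?_
      field_simp
    · refine (((hid x).sin.const_mul (-(A * k))).fun_add
        ((hid x).cos.const_mul B)).congr_deriv ?_
      rw [← hsq]
      field_simp
      ring

/-- The function `r = -g'/g` satisfies `r' = μ + r²`, and hence passes from `r₀` to `r₁` in the time
`∫ ds / (μ + s²)`. The proof avoids a discussion of the zeros of `g`: with `X(s)` the time at which
`s` should be reached, `(g'(X(s)) + s g(X(s)))² / (μ + s²)` is constant. -/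
theorem exists_solution_of_integral_eq {μ r₀ r₁ T : ℝ} (hne : ∀ s ∈ uIcc r₀ r₁, μ + s ^ 2 ≠ 0)
    (hT : ∫ s in r₀..r₁, (μ + s ^ 2)⁻¹ = T) (hT0 : 0 ≤ T) : ∃ g dg : ℝ → ℝ,
    (∀ x, HasDerivAt g (dg x) x) ∧ (∀ x, HasDerivAt dg (-(μ * g x)) x) ∧ g 0 = 1 ∧
    dg 0 = -r₀ ∧ dg T = -r₁ * g T ∧ ∀ t ∈ Icc 0 T, 0 < g t := by
  obtain ⟨g, dg, hg, hdg, g0, dg0⟩ := exists_solution μ 1 (-r₀)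
  have hcont : ∀ s ∈ uIcc r₀ r₁, ContinuousAt (fun s => (μ + s ^ 2)⁻¹) s := fun s hs =>
    (continuousAt_const.add (continuousAt_id.pow 2)).inv₀ (hne s hs)
  set X : ℝ → ℝ := fun s => ∫ t in r₀..s, (μ + t ^ 2)⁻¹ with hX
  have hXd : ∀ s ∈ uIcc r₀ r₁, HasDerivAt X (μ + s ^ 2)⁻¹ s := by
    intro s hs
    refine intervalIntegral.integral_hasDerivAt_right ?_ ?_ (hcont s hs)
    · refine ContinuousOn.intervalIntegrable fun t ht => (hcont t ?_).continuousWithinAt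
      exact uIcc_subset_uIcc_left hs ht
    · have : Measurable fun t : ℝ => (μ + t ^ 2)⁻¹ := by fun_prop
      exact this.stronglyMeasurable.stronglyMeasurableAtFilter
  have hX0 : X r₀ = 0 := intervalIntegral.integral_same
  have hP : ∀ s ∈ uIcc r₀ r₁, dg (X s) + s * g (X s) = 0 := by
    have hd : ∀ s ∈ uIcc r₀ r₁, HasDerivWithinAt
        (fun s => (dg (X s) + s * g (X s)) ^ 2 / (μ + s ^ 2)) 0 (uIcc r₀ r₁) s := by
      intro s hs
      have h0 := hne s hs
      have c1 := (hdg (X s)).comp s (hXd s hs)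
      have c2 := (hg (X s)).comp s (hXd s hs)
      have c3 := ((c1.fun_add ((hasDerivAt_id s).fun_mul c2)).fun_pow 2).fun_div
        (((hasDerivAt_id s).fun_pow 2).const_add μ) h0
      refine c3.hasDerivWithinAt.congr_deriv ?_
      simp only [id, Function.comp]
      field_simp
      push_cast
      ring
    intro s hs
    have e := (convex_uIcc r₀ r₁).norm_image_sub_le_of_norm_hasDerivWithin_le (C := 0) hd
      (fun x _ => by simp) left_mem_uIcc hs
    rw [zero_mul, hX0, g0, dg0] at e
    have e1 := norm_le_zero_iff.1 e
    simp only [mul_one, neg_add_cancel, ne_eq, OfNat.ofNat_ne_zero, not_false_eq_true, zero_pow,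
      zero_div, sub_zero, div_eq_zero_iff, pow_eq_zero_iff, hne s hs, or_false] at e1
    exact e1
  have hE : ∀ x, dg x ^ 2 + μ * g x ^ 2 = r₀ ^ 2 + μ := by
    have hd : ∀ x, HasDerivAt (fun x => dg x ^ 2 + μ * g x ^ 2) 0 x := fun x => by
      refine (((hdg x).fun_pow 2).fun_add (((hg x).fun_pow 2).const_mul μ)).congr_deriv ?_
      push_cast
      ring
    intro x
    have := is_const_of_deriv_eq_zero (fun x => (hd x).differentiableAt) (fun x => (hd x).deriv) x 0
    simp only [g0, dg0] at this
    linarith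
  have hXT : X r₁ = T := hT
  have hg0 : ∀ t ∈ Icc 0 T, g t ≠ 0 := by
    intro t ht h0
    have hXc : ContinuousOn X (uIcc r₀ r₁) := fun s hs => (hXd s hs).continuousAt.continuousWithinAt
    have hsub := intermediate_value_uIcc hXc
    rw [hX0, hXT, uIcc_of_le hT0] at hsub
    obtain ⟨s, hs, rfl⟩ := hsub ht
    have h1 := hP s hs
    have h2 := hE (X s)
    rw [h0] at h1 h2
    have h3 : dg (X s) = 0 := by linarith
    rw [h3] at h2
    exact hne r₀ left_mem_uIcc (by linarith)
  refine ⟨g, dg, hg, hdg, g0, dg0, ?_, fun t ht => ?_⟩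
  · have := hP r₁ right_mem_uIcc
    rw [hXT] at this
    linarith
  · by_contra! hle
    have hgc : ContinuousOn g (Icc 0 t) := fun x _ => (hg x).continuousAt.continuousWithinAt
    obtain ⟨x, hx, hx0⟩ := intermediate_value_Icc' ht.1 hgc ⟨hle, by rw [g0]; exact zero_le_one⟩
    exact hg0 x ⟨hx.1, hx.2.trans ht.2⟩ hx0

/-- If `p` vanishes at `c` at least to the first order, then the integrals of `1 / (ε + p)` blow up
as `ε → 0`; as they tend to zero for `ε → ∞`, they take the value one. -/
theorem exists_integral_inv_add_eq_one {p : ℝ → ℝ} {c d₁ d₂ K : ℝ} (hp : Continuous p)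
    (h1 : c < d₁) (h2 : c ≤ d₂) (hp1 : ∀ s ∈ Icc c d₁, 0 ≤ p s) (hp2 : ∀ s ∈ Icc c d₂, 0 ≤ p s)
    (hK : 0 < K) (hpK : ∀ s ∈ Icc c d₁, p s ≤ K * (s - c)) :
    ∃ ε > 0, (∫ s in c..d₁, (ε + p s)⁻¹) + ∫ s in c..d₂, (ε + p s)⁻¹ = 1 := by
  set Δ := d₁ - c with hΔ
  have hΔ0 : 0 < Δ := by linarith
  have hexp : 0 < Real.exp K - 1 := by
    have := Real.add_one_lt_exp hK.ne'
    linarith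
  set ε₁ := K * Δ / (Real.exp K - 1) with hε₁
  have hε₁0 : 0 < ε₁ := by positivity
  set ε₂ := ε₁ + (d₁ - c) + (d₂ - c) with hε₂
  have h12 : ε₁ ≤ ε₂ := by linarith
  -- the truncations make the integrand continuous in both variables
  set G : ℝ → ℝ → ℝ := fun d ε => ∫ s in c..d, (max ε ε₁ + max (p s) 0)⁻¹ with hG
  have hGc : ∀ d, Continuous (G d) := fun d => by
    refine intervalIntegral.continuous_parametric_intervalIntegral_of_continuous' ?_ c d
    refine Continuous.inv₀ (by fun_prop) fun x => ?_
    have a1 : ε₁ ≤ max x.1 ε₁ := le_max_right _ _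
    have a2 : 0 ≤ max (p x.2) 0 := le_max_right _ _
    exact (by linarith : 0 < max x.1 ε₁ + max (p x.2) 0).ne'
  have hGe : ∀ d, c ≤ d → (∀ s ∈ Icc c d, 0 ≤ p s) → ∀ ε, ε₁ ≤ ε →
      G d ε = ∫ s in c..d, (ε + p s)⁻¹ := fun d hd hpd ε hε => by
    refine intervalIntegral.integral_congr fun s hs => ?_
    rw [uIcc_of_le hd] at hs
    simp only [max_eq_left hε, max_eq_left (hpd s hs)]
  have hint : ∀ d, c ≤ d → (∀ s ∈ Icc c d, 0 ≤ p s) → ∀ ε, 0 < ε →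
      IntervalIntegrable (fun s => (ε + p s)⁻¹) volume c d := fun d hd hpd ε hε => by
    refine ContinuousOn.intervalIntegrable ?_
    rw [uIcc_of_le hd]
    refine ContinuousOn.inv₀ (by fun_prop) fun s hs => ?_
    linarith [hpd s hs]
  have hup : ∀ d, c ≤ d → (∀ s ∈ Icc c d, 0 ≤ p s) →
      ∫ s in c..d, (ε₂ + p s)⁻¹ ≤ (d - c) / ε₂ := fun d hd hpd => by
    have : (d - c) / ε₂ = ∫ _ in c..d, ε₂⁻¹ := by
      rw [intervalIntegral.integral_const, smul_eq_mul, div_eq_mul_inv]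
    rw [this]
    refine intervalIntegral.integral_mono_on hd (hint d hd hpd ε₂ (by linarith))
      _root_.intervalIntegrable_const fun s hs => ?_
    exact inv_anti₀ (by linarith) (by linarith [hpd s hs])
  have hlow : 1 ≤ ∫ s in c..d₁, (ε₁ + p s)⁻¹ := by
    have hpos : ∀ s ∈ Icc c d₁, 0 < ε₁ + K * (s - c) := fun s hs => by
      have : 0 ≤ K * (s - c) := mul_nonneg hK.le (by linarith [hs.1])
      linarith
    have hi : IntervalIntegrable (fun s => (ε₁ + K * (s - c))⁻¹) volume c d₁ := by
      refine ContinuousOn.intervalIntegrable ?_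
      rw [uIcc_of_le h1.le]
      exact ContinuousOn.inv₀ (by fun_prop) fun s hs => (hpos s hs).ne'
    have e : ∫ s in c..d₁, (ε₁ + K * (s - c))⁻¹ = 1 := by
      have hd : ∀ s ∈ uIcc c d₁, HasDerivAt (fun s => Real.log (ε₁ + K * (s - c)) / K)
          (ε₁ + K * (s - c))⁻¹ s := fun s hs => by
        rw [uIcc_of_le h1.le] at hs
        have h0 := (hpos s hs).ne'
        refine ((((((hasDerivAt_id s).sub_const c).const_mul K).const_add ε₁).log
          h0).div_const K).congr_deriv ?_
        simp only [id]
        field_simp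
      rw [intervalIntegral.integral_eq_sub_of_hasDerivAt hd hi, ← sub_div, sub_self, mul_zero,
        add_zero, ← Real.log_div (hpos d₁ ⟨h1.le, le_rfl⟩).ne' hε₁0.ne']
      have : (ε₁ + K * (d₁ - c)) / ε₁ = Real.exp K := by
        rw [hε₁, ← hΔ]
        field_simp
        ring
      rw [this, Real.log_exp, div_self hK.ne']
    rw [← e]
    refine intervalIntegral.integral_mono_on h1.le hi (hint d₁ h1.le hp1 ε₁ hε₁0) fun s hs => ?_
    exact inv_anti₀ (by linarith [hp1 s hs]) (by linarith [hpK s hs])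
  have hlow2 : 0 ≤ ∫ s in c..d₂, (ε₁ + p s)⁻¹ :=
    intervalIntegral.integral_nonneg h2 fun s hs => inv_nonneg.2 (by linarith [hp2 s hs])
  have hup2 : (∫ s in c..d₁, (ε₂ + p s)⁻¹) + ∫ s in c..d₂, (ε₂ + p s)⁻¹ ≤ 1 := by
    have a3 : (d₁ - c) / ε₂ + (d₂ - c) / ε₂ ≤ 1 := by
      rw [← add_div, div_le_one (by linarith)]
      linarith
    linarith [hup d₁ h1.le hp1, hup d₂ h2 hp2]
  obtain ⟨ε, hε, he⟩ := intermediate_value_Icc' (f := fun ε => G d₁ ε + G d₂ ε) h12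
    ((hGc d₁).add (hGc d₂)).continuousOn
    (show (1 : ℝ) ∈ Icc _ _ from ⟨by
      simp only [hGe d₁ h1.le hp1 ε₂ h12, hGe d₂ h2 hp2 ε₂ h12]
      exact hup2, by
      simp only [hGe d₁ h1.le hp1 ε₁ le_rfl, hGe d₂ h2 hp2 ε₁ le_rfl]
      linarith⟩)
  refine ⟨ε, hε₁0.trans_le hε.1, ?_⟩
  simpa only [hGe d₁ h1.le hp1 ε hε.1, hGe d₂ h2 hp2 ε hε.1] using he

theorem isSolutionOn_of_hasDerivAt {μ c d : ℝ} {g dg : ℝ → ℝ} (hg : ∀ x, HasDerivAt g (dg x) x)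
    (hdg : ∀ x, HasDerivAt dg (-(μ * g x)) x) : IsSolutionOn μ c d g dg :=
  ⟨fun x _ => (hg x).hasDerivWithinAt, fun x _ => (hdg x).hasDerivWithinAt⟩

/-- For `a > 1/2` the two times in which `-y'/y` grows from `1/2` to `a` and from `1/2` to `b` sum
up to one for a suitable spectral parameter, so that both branches fit into `[0,1]`. -/
theorem exists_hasPositiveSolution {k₀ k₁ : ℝ} (hk₀ : 1 / 2 < k₀ ^ 2) (hk₁ : 1 / 2 < k₁ ^ 2) :
    ∃ μ ζ : ℝ, ζ ∈ Ioo (0 : ℝ) 1 ∧ -(k₀ ^ 4) ≤ μ ∧ HasPositiveSolution k₀ k₁ μ ζ := by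
  have hp : ∀ d : ℝ, ∀ s ∈ Icc (1 / 2) d, 0 ≤ s ^ 2 - 1 / 4 := fun d s hs => by nlinarith [hs.1]
  obtain ⟨ε, hε, hsum⟩ := exists_integral_inv_add_eq_one (p := fun s => s ^ 2 - 1 / 4)
    (K := k₀ ^ 2 + 1 / 2) (by fun_prop) hk₀ hk₁.le (hp _) (hp _) (by linarith)
    (fun s hs => by nlinarith [hs.1, hs.2])
  set μ := ε - 1 / 4 with hμ
  have he : ∀ d : ℝ, ∫ s in (1 / 2 : ℝ)..d, (ε + (s ^ 2 - 1 / 4))⁻¹ =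
      ∫ s in (1 / 2 : ℝ)..d, (μ + s ^ 2)⁻¹ := fun d => by
    congr 1
    funext s
    congr 1
    rw [hμ]
    ring
  rw [he, he] at hsum
  have hpos : ∀ d, 1 / 2 < d → ∀ s ∈ uIcc (1 / 2) d, 0 < μ + s ^ 2 := fun d hd s hs => by
    rw [uIcc_of_le hd.le] at hs
    nlinarith [hs.1]
  have hTpos : ∀ d, 1 / 2 < d → 0 < ∫ s in (1 / 2 : ℝ)..d, (μ + s ^ 2)⁻¹ := fun d hd => by
    refine intervalIntegral.intervalIntegral_pos_of_pos_on ?_ (fun s hs => ?_) hd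
    · exact ContinuousOn.intervalIntegrable
        (ContinuousOn.inv₀ (by fun_prop) fun s hs => (hpos d hd s hs).ne')
    · refine inv_pos.2 (hpos d hd s ?_)
      rw [uIcc_of_le hd.le]
      exact Ioo_subset_Icc_self hs
  have t0 := hTpos _ hk₀
  have t1 := hTpos _ hk₁
  obtain ⟨g, dg, hg, hdg, g0, dg0, gT, gpos⟩ := exists_solution_of_integral_eq
    (fun s hs => (hpos _ hk₀ s hs).ne') rfl t0.le
  obtain ⟨f, df, hf, hdf, f0, df0, fT, fpos⟩ := exists_solution_of_integral_eq
    (fun s hs => (hpos _ hk₁ s hs).ne') rfl t1.le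
  set ζ := ∫ s in (1 / 2 : ℝ)..k₀ ^ 2, (μ + s ^ 2)⁻¹ with hζ
  have ht1 : ∫ s in (1 / 2 : ℝ)..k₁ ^ 2, (μ + s ^ 2)⁻¹ = 1 - ζ := by linarith
  rw [ht1] at fT fpos t1
  have hgc : Continuous g := continuous_iff_continuousAt.2 fun x => (hg x).continuousAt
  have hfc : Continuous f := continuous_iff_continuousAt.2 fun x => (hf x).continuousAt
  have hdgc : Continuous dg := continuous_iff_continuousAt.2 fun x => (hdg x).continuousAt
  have hdfc : Continuous df := continuous_iff_continuousAt.2 fun x => (hdf x).continuousAt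
  set y : ℝ → ℝ := fun x => if x ≤ ζ then g (ζ - x) else f (x - ζ) with hy
  have hyc : Continuous y := by
    refine Continuous.if_le (by fun_prop) (by fun_prop) continuous_id continuous_const ?_
    rintro x rfl
    simp [g0, f0]
  have yl : ∀ x, x ≤ ζ → y x = g (ζ - x) := fun x hx => if_pos hx
  have yr : ∀ x, ζ < x → y x = f (x - ζ) := fun x hx => if_neg hx.not_ge
  have dl : ∀ x, HasDerivAt (fun x => g (ζ - x)) (-dg (ζ - x)) x := fun x => by
    exact (hg (ζ - x)).comp_const_sub ζ x
  have ddl : ∀ x, HasDerivAt (fun x => -dg (ζ - x)) (-(μ * g (ζ - x))) x := fun x => by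
    simpa using ((hdg (ζ - x)).comp_const_sub ζ x).fun_neg
  have dr : ∀ x, HasDerivAt (fun x => f (x - ζ)) (df (x - ζ)) x := fun x => by
    exact (hf (x - ζ)).comp_sub_const x ζ
  have ddr : ∀ x, HasDerivAt (fun x => df (x - ζ)) (-(μ * f (x - ζ))) x := fun x => by
    exact (hdf (x - ζ)).comp_sub_const x ζ
  have el : ∀ x, x < ζ → HasDerivAt y (-dg (ζ - x)) x := fun x hx => by
    refine (dl x).congr_of_eventuallyEq ?_
    filter_upwards [Iio_mem_nhds hx] with t ht using yl t (le_of_lt ht)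
  have er : ∀ x, ζ < x → HasDerivAt y (df (x - ζ)) x := fun x hx => by
    refine (dr x).congr_of_eventuallyEq ?_
    filter_upwards [Ioi_mem_nhds hx] with t ht using yr t ht
  refine ⟨μ, ζ, ⟨t0, by linarith⟩, by nlinarith, y, hyc.continuousOn, fun x hx => ?_, ?_,
    -dg ζ, -dg 0, df 0, df (1 - ζ), ?_, ?_, ?_, ?_, ?_, ?_, ?_, ?_⟩
  · rcases le_or_gt x ζ with h | h
    · rw [yl x h]
      exact gpos _ ⟨by linarith, by linarith [hx.1]⟩
    · rw [yr x h]
      exact fpos _ ⟨by linarith, by linarith [hx.2]⟩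
  · rintro x (hx | hx)
    · refine ⟨(el x hx.2).differentiableAt, ?_⟩
      rw [yl x hx.2.le]
      refine (ddl x).congr_of_eventuallyEq ?_
      filter_upwards [Iio_mem_nhds hx.2] with t ht using (el t ht).deriv
    · refine ⟨(er x hx.1).differentiableAt, ?_⟩
      rw [yr x hx.1]
      refine (ddr x).congr_of_eventuallyEq ?_
      filter_upwards [Ioi_mem_nhds hx.1] with t ht using (er t ht).deriv
  · have : Tendsto (fun x => -dg (ζ - x)) (𝓝[>] 0) (𝓝 (-dg ζ)) := by
      have hc : Continuous fun x => -dg (ζ - x) := by fun_prop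
      simpa using (hc.tendsto 0).mono_left nhdsWithin_le_nhds
    refine this.congr' ?_
    filter_upwards [Ioo_mem_nhdsGT t0] with t ht using (el t ht.2).deriv.symm
  · have : Tendsto (fun x => -dg (ζ - x)) (𝓝[<] ζ) (𝓝 (-dg 0)) := by
      have hc : Continuous fun x => -dg (ζ - x) := by fun_prop
      simpa using (hc.tendsto ζ).mono_left nhdsWithin_le_nhds
    refine this.congr' ?_
    filter_upwards [self_mem_nhdsWithin] with t ht using (el t ht).deriv.symm
  · have : Tendsto (fun x => df (x - ζ)) (𝓝[>] ζ) (𝓝 (df 0)) := by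
      have hc : Continuous fun x => df (x - ζ) := by fun_prop
      simpa using (hc.tendsto ζ).mono_left nhdsWithin_le_nhds
    refine this.congr' ?_
    filter_upwards [self_mem_nhdsWithin] with t ht using (er t ht).deriv.symm
  · have : Tendsto (fun x => df (x - ζ)) (𝓝[<] 1) (𝓝 (df (1 - ζ))) := by
      have hc : Continuous fun x => df (x - ζ) := by fun_prop
      exact (hc.tendsto 1).mono_left nhdsWithin_le_nhds
    refine this.congr' ?_
    filter_upwards [Ioo_mem_nhdsLT (by linarith : ζ < 1)] with t ht using (er t ht.1).deriv.symm
  · rw [yl 0 t0.le, gT, sub_zero]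
    ring
  · rw [yl ζ le_rfl, sub_self, g0, dg0]
    norm_num
  · rw [yl ζ le_rfl, sub_self, g0, df0]
    norm_num
  · rw [yr 1 (by linarith), fT]
    ring

/-! ### The potential supported at the left end point -/

/-- The first eigenfunction for `-δ_0`: here `-y'/y` passes from `1 - a` to `b` in unit time. -/
theorem exists_positive_solution_of_robin {a b : ℝ} (ha : a ≤ 1 / 2) (hb : 0 ≤ b) :
    ∃ m, ∃ y v : ℝ → ℝ, IsSolutionOn m 0 1 y v ∧ (∀ x ∈ Icc (0 : ℝ) 1, 0 < y x) ∧
      v 0 = (a - 1) * y 0 ∧ v 1 = -b * y 1 := by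
  have hr : 0 < 1 - a := by linarith
  rcases lt_trichotomy (1 - a) b with hlt | heq | hlt
  · obtain ⟨ε, hε, hsum⟩ := exists_integral_inv_add_eq_one (p := fun s => s ^ 2 - (1 - a) ^ 2)
      (d₂ := 1 - a) (K := b + (1 - a)) (by fun_prop) hlt le_rfl
      (fun s hs => by nlinarith [hs.1]) (fun s hs => by nlinarith [hs.1]) (by linarith)
      (fun s hs => by nlinarith [hs.1, hs.2])
    rw [intervalIntegral.integral_same, add_zero] at hsum
    have he : ∫ s in (1 - a)..b, (ε - (1 - a) ^ 2 + s ^ 2)⁻¹ = 1 := by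
      refine Eq.trans ?_ hsum
      congr 1
      funext s
      congr 1
      ring
    obtain ⟨g, dg, hg, hdg, g0, dg0, gT, gpos⟩ := exists_solution_of_integral_eq (fun s hs => by
      rw [uIcc_of_le hlt.le] at hs
      have : 0 < ε - (1 - a) ^ 2 + s ^ 2 := by nlinarith [hs.1]
      exact this.ne') he zero_le_one
    refine ⟨_, g, dg, isSolutionOn_of_hasDerivAt hg hdg, gpos, ?_, gT⟩
    rw [g0, dg0]
    ring
  · refine ⟨-b ^ 2, fun x => Real.exp (-b * x), fun x => -b * Real.exp (-b * x), ?_,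
      fun x _ => Real.exp_pos _, ?_, rfl⟩
    · have hd : ∀ x, HasDerivAt (fun x => Real.exp (-b * x)) (-b * Real.exp (-b * x)) x := fun x => by
        have h1 : HasDerivAt (fun x => -b * x) (-b) x := by
          simpa using (hasDerivAt_id x).const_mul (-b)
        rw [mul_comm (-b)]
        exact h1.exp
      refine isSolutionOn_of_hasDerivAt hd fun x => ?_
      refine ((hd x).const_mul (-b)).congr_deriv ?_
      ring
    · simp only
      rw [← heq]
      ring
  · obtain ⟨ε, hε, hsum⟩ := exists_integral_inv_add_eq_one (p := fun s => (1 - a) ^ 2 - s ^ 2)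
      (c := -(1 - a)) (d₁ := -b) (d₂ := -(1 - a)) (K := 2 * (1 - a)) (by fun_prop) (by linarith)
      le_rfl (fun s hs => by nlinarith [hs.1, hs.2]) (fun s hs => by nlinarith [hs.1, hs.2])
      (by linarith) (fun s hs => by nlinarith [hs.1, hs.2])
    rw [intervalIntegral.integral_same, add_zero] at hsum
    have he : ∫ s in (-b)..(-(1 - a)), (-(ε + (1 - a) ^ 2) + s ^ 2)⁻¹ = 1 := by
      refine Eq.trans ?_ hsum
      rw [intervalIntegral.integral_symm, ← intervalIntegral.integral_neg]
      congr 1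
      funext s
      rw [← inv_neg]
      congr 1
      ring
    obtain ⟨g, dg, hg, hdg, g0, dg0, gT, gpos⟩ := exists_solution_of_integral_eq (fun s hs => by
      rw [uIcc_of_ge (by linarith)] at hs
      have : -(ε + (1 - a) ^ 2) + s ^ 2 < 0 := by nlinarith [hs.1, hs.2]
      exact this.ne) he zero_le_one
    have hsol := (isSolutionOn_of_hasDerivAt (c := 0) (d := 1) hg hdg).reflect 1
    simp only [sub_self, sub_zero] at hsol
    refine ⟨_, _, _, hsol, fun x hx => gpos _ ⟨by linarith [hx.2], by linarith [hx.1]⟩, ?_, ?_⟩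
    · simp only [sub_zero, gT]
      ring
    · simp only [sub_self, g0, dg0]
      ring

theorem exists_m₁negEqAttainedAt_dirac_zero {k₀ k₁ : ℝ} (hk₀ : 0 ≤ k₀) (hk : k₀ ≤ k₁)
    (ha : k₀ ^ 2 ≤ 1 / 2) :
    ∃ m : ℝ, IsLeast {e | IsEigenvalue (k₀ ^ 2 - 1) (k₁ ^ 2) (fun _ => 0) e} m ∧
      M₁negEqAttainedAt k₀ k₁ m (dirac 0) := by
  obtain ⟨m, y, v, h, hy, h0, h1⟩ := exists_positive_solution_of_robin ha (sq_nonneg k₁)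
  have m0 : (0 : ℝ) ∈ Icc (0 : ℝ) 1 := ⟨le_rfl, zero_le_one⟩
  have m1 : (1 : ℝ) ∈ Icc (0 : ℝ) 1 := ⟨zero_le_one, le_rfl⟩
  have w0 : v 0 / y 0 = k₀ ^ 2 - 1 := by rw [h0, mul_div_cancel_right₀ _ (hy 0 m0).ne']
  have w1 : v 1 / y 1 = -k₁ ^ 2 := by rw [h1, mul_div_cancel_right₀ _ (hy 1 m1).ne']
  have hgs : IsGroundState (k₀ ^ 2) (k₁ ^ 2) m 0 y (fun _ => k₀ ^ 2 * y 0) v := by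
    refine ⟨hy, ⟨fun x hx => ?_, fun x hx => ?_⟩, h, rfl, h1, by rw [h0]; ring⟩ <;>
    · rw [Icc_self] at hx ⊢
      rw [hx]
      exact hasDerivWithinAt_iff_hasFDerivWithinAt.2 .singleton
  refine ⟨m, isLeast_of_riccati (W := fun x => v x / y x)
    (absolutelyContinuous_of_hasDerivWithinAt zero_le_one (h.hasDerivWithinAt_logDeriv hy)
      (continuousOn_const.sub ((h.continuousOn_logDeriv hy).pow 2)))
    _root_.intervalIntegrable_const (Eventually.of_forall fun x hx => ?_) w0 w1,
    IsGroundState.m₁negEqAttainedAt (ζ := 0) zero_lt_one hgs ?_⟩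
  · rw [((h.hasDerivWithinAt_logDeriv hy x (Ioo_subset_Icc_self hx)).hasDerivAt
      (Icc_mem_nhds hx.1 hx.2)).deriv]
    ring
  · rcases le_total 0 (v 0 ^ 2 + m * y 0 ^ 2) with hE | hE
    · refine hgs.dominatesDeltas m0 (fun x hx => absurd hx.2 hx.1.not_gt) fun x hx => ?_
      have := h.antitoneOn_logDeriv hy m0 hE m0 hx hx.1
      simp only [w0] at this
      linarith
    · exact dominatesDeltas_of_monotoneOn (sq_nonneg k₀) (pow_le_pow_left₀ hk₀ hk 2) h hy w0 w1
        (h.monotoneOn_logDeriv hy m0 hE)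

end SturmDelta

theorem theorem1p3p4 (k₀ k₁ : ℝ) (hk₀ : 0 ≤ k₀) (hk : k₀ ≤ k₁) :
    (∀ μ ζ : ℝ, ∀ hζ : ζ ∈ Set.Ioo (0 : ℝ) 1, -(k₀ ^ 4) ≤ μ → HasPositiveSolution k₀ k₁ μ ζ →
      M₁negEqAttainedAt k₀ k₁ μ (dirac ⟨ζ, Set.Ioo_subset_Icc_self hζ⟩)) ∧
    ((¬ ∃ μ ζ : ℝ, ζ ∈ Set.Ioo (0 : ℝ) 1 ∧ -(k₀ ^ 4) ≤ μ ∧ HasPositiveSolution k₀ k₁ μ ζ) →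
      ∃ m : ℝ, IsLeast {e | IsEigenvalue (k₀ ^ 2 - 1) (k₁ ^ 2) (fun _ => 0) e} m ∧
        M₁negEqAttainedAt k₀ k₁ m (dirac 0)) := by
  refine ⟨fun μ ζ hζ hμ h => m₁negEqAttainedAt_of_hasPositiveSolution
    (ζ := ⟨ζ, Set.Ioo_subset_Icc_self hζ⟩) hk₀ hk hζ hμ h, fun hno => ?_⟩
  refine exists_m₁negEqAttainedAt_dirac_zero hk₀ hk (not_lt.1 fun hlt => hno ?_)
  exact exists_hasPositiveSolution hlt (hlt.trans_le (pow_le_pow_left₀ hk₀ hk 2))
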